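/- **Setting.** Fix $T\ge 1$, $q\in[0,1]$ and $0\le\delta_1<\delta_0\le\frac12$. The block-fading channel takes in block $k=1,2,\dots$ an input word $\mathbf X_k\in\{0,1\}^T$; its state $S_k\in\{0,1\}$ satisfies $\Pr[S_k=1]=q$, independently over $k$ and of the inputs, and given $S_k=s$ the output word is $\mathbf X_k\oplus\mathbf Z_k$ with $\mathbf Z_k$ i.i.d. $\mathrm{Bern}(\delta_s)$, independently over the blocks. The receiver observes $\mathbf Y_k=(S_k,\mathbf X_k\oplus\mathbf Z_k)$. Inputs have i.i.d. $\mathrm{Bern}(\frac12)$ entries. The information density of blocks $a,\dots,b$ is $$i(\mathbf x_a^b;\mathbf y_a^b)=\sum_{k=a}^b\log\frac{P(\mathbf y_k\mid \mathbf x_k,s_k)}{P(\mathbf y_k\mid s_k)}\in[-\infty,\infty)$$ (zero if $b<a$), where $P(\cdot\mid s)$ is the output distribution in state $s$ for the $\mathrm{Bern}(\frac12)$ inputs. **EMS-SF codes.** Let $N\ge1$, let $M_1,\dots,M_N\ge 1$ be integers, $\mathcal M_n=\{1,\dots,M_n\}$ and $n'=\min(n,N)$. An $(l,(M_1,\dots,M_N),\epsilon)$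 EMS-SF code consists of (deterministic) encoders $\mathbf c_n:\mathcal M_1\times\dots\times\mathcal M_{n'}\to\{0,1\}^T$ for $n\ge1$, decoders $\mathbf g_n$ mapping $(\mathbf y_1,\dots,\mathbf y_n)$ to $\mathcal M_1\times\dots\times\mathcal M_{n'}$, and a stopping time $\tau^*\ge1$ of the sequence $\mathbf Y_1,\mathbf Y_2,\dots$ of received blocks, such that, when $(J_1,\dots,J_N)$ is uniform on $\mathcal M_1\times\dots\times\mathcal M_N$, independent of states and noise, and $\mathbf c_n(J_1,\dots,J_{n'})$ is sent in block $n$, $$\mathbb E[\tau^*]\le l<\infty,\qquad \Pr\big[\mathbf g_{\tau^*}(\mathbf Y_1,\dots,\mathbf Y_{\tau^*})\ne(J_1,\dots,J_{\min(\tau^*,N)})\big]\le\epsilon .$$ **Theorem.** Fix $\gamma_1,\dots,\gamma_N\in\mathbb R$ and set $\gamma_n=0$ for $n>N$. Let $(\mathbf X_k)_{k\ge1}$ and $(\overline{\mathbf X}_k)_{k\ge1}$ be independent sequences of independent $\mathrm{Bern}(\frac12)$ input words, independent of the states and noise, and let $\mathbf Y_k$ be the output of the channel when $\mathbf X_k$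 is its input. Define (with $\inf\emptyset=\infty$) $$\tau=\inf\Big\{k\ge1:\ i(\mathbf X_1^k;\mathbf Y_1^k)\ge\sum_{i=1}^k\gamma_i\Big\},$$ $$\overline\tau_n=\inf\Big\{k\ge n:\ i(\mathbf X_1^{n-1};\mathbf Y_1^{n-1})+i(\overline{\mathbf X}_n^k;\mathbf Y_n^k)\ge\sum_{i=1}^k\gamma_i\Big\}.$$ Then for all integers $M_1,\dots,M_N\ge1$ there exists an $(l,(M_1,\dots,M_N),\epsilon)$ EMS-SF code such that $$l\le\mathbb E[\tau]\qquad\text{and}\qquad \epsilon\le\mathbb E\Big[\sum_{n=1}^{\min(\tau,N)}(M_n-1)\Big(\prod_{i=n+1}^{\min(\tau,N)}M_i\Big)\,\mathbf 1\{\overline\tau_n\le\tau\}\Big],$$ where the right-hand side is the same if $\mathbf 1\{\overline\tau_n\le\tau\}$ is replaced by $\Pr[\overline\tau_n\le\tau\mid\tau]$. -/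

import Mathlib

open MeasureTheory ProbabilityTheory
open scoped ENNReal NNReal

namespace EMS

noncomputable section

/-- A binary block of `T` channel uses, an element of `{0,1}^T`. -/
abbrev Block (T : ℕ) : Type := Fin T → Bool

/-- What the receiver observes in one block: the channel state and the channel output word
(the receiver has full channel state information). -/
abbrev Output (T : ℕ) : Type := Bool × Block T

/-- The blockwise XOR. -/
def bxor {T : ℕ} (x z : Block T) : Block T := fun t => xor (x t) (z t)

/-- The law on `{0,1}^T` with i.i.d. `Bern(p)` entries. -/
def bernBlock (T : ℕ) (p : unitInterval) : Measure (Block T) :=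
  Measure.pi fun _ => bernoulliMeasure true false p

/-- The law of a channel input block of a random codebook: i.i.d. `Bern(1/2)` entries. -/
def inputLaw (T : ℕ) : Measure (Block T) :=
  bernBlock T ⟨1 / 2, by norm_num, by norm_num⟩

/-- The binary block-fading channel with two states and coherence time `T`: in each block the
state is `1` (`true`) with probability `q`, independently of the other blocks, and in state `s`
the channel is a BSC with crossover probability `δ s`. -/
structure Channel where
  /-- number of channel uses per block -/
  T : ℕ
  T_pos : 0 < T
  /-- probability of the state `1` -/
  q : unitInterval
  /-- crossover probabilities -/
  δ : Bool → unitInterval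
  δ_le_half : ∀ s, (δ s : ℝ) ≤ 1 / 2
  δ_lt : δ true < δ false

namespace Channel

variable (ch : Channel)

/-- The joint law of the state and of the noise word in one block. -/
def stateNoiseLaw : Measure (Bool × Block ch.T) :=
  unitInterval.toNNReal ch.q • (bernBlock ch.T (ch.δ true)).map (Prod.mk true)
    + unitInterval.toNNReal (unitInterval.symm ch.q) •
      (bernBlock ch.T (ch.δ false)).map (Prod.mk false)

/-- The output of one block on input `x` when the state and the noise word are `w`. -/
def out (x : Block ch.T) (w : Bool × Block ch.T) : Output ch.T := (w.1, bxor x w.2)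

/-- `P(y | x, s)`: the probability that the output word is `y` given the input `x` and the
state `s`. -/
def trans (x : Block ch.T) (o : Output ch.T) : ℝ≥0∞ :=
  bernBlock ch.T (ch.δ o.1) {z | bxor x z = o.2}

/-- `P(y | s)`: the probability of the output word `y` given the state `s`, when the input is
distributed according to `inputLaw`. -/
def outProb (o : Output ch.T) : ℝ≥0∞ := ∫⁻ x, ch.trans x o ∂inputLaw ch.T

/-- The information density `i(x ; y)` of one block, in nats. It is `⊥` if `y` is impossible
given `x`. As the receiver knows the state, and the state is independent of the input, it equals
`log (P(y | x, s) / P(y | s))`. -/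
def density (x : Block ch.T) (o : Output ch.T) : EReal :=
  ENNReal.log (ch.trans x o / ch.outProb o)

/-- The information density `i(x_a^b ; y_a^b)` of the blocks `a, …, b` (zero if `b < a`). The
channel is memoryless and the inputs are independent across blocks, so it is a sum. -/
def densityIcc (x : ℕ → Block ch.T) (y : ℕ → Output ch.T) (a b : ℕ) : EReal :=
  ∑ k ∈ Finset.Icc a b, ch.density (x k) (y k)

/-- The law of the states and noise words of all blocks, independent across the blocks. Blocks
are numbered `1, 2, …`; the coordinate `0` of a sequence is never used. -/
def pathLaw : Measure (ℕ → Bool × Block ch.T) := Measure.infinitePi fun _ => ch.stateNoiseLaw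

end Channel

/-- The tuples `(j_1, …, j_n)` in `{1,…,M_1} × … × {1,…,M_n}`. The entry with index `i : Fin n`
is the message of block `i + 1`. -/
abbrev Messages (M : ℕ → ℕ) (n : ℕ) : Type := (i : Fin n) → Fin (M (i.1 + 1))

/-- The first `min n N` of `N` messages. -/
def restrict {M : ℕ → ℕ} {N : ℕ} (n : ℕ) (j : Messages M N) : Messages M (min n N) :=
  fun i => j (Fin.castLE (min_le_right n N) i)

/-- The blocks `1, …, n` of a sequence. -/
def prefixOf {α : Type} (y : ℕ → α) (n : ℕ) : Fin n → α := fun i => y (i.1 + 1)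

/-- An `(l, (M_1, …, M_N), ε)` EMS-SF code for the channel `ch`. -/
structure SFCode (ch : Channel) (N : ℕ) (M : ℕ → ℕ) (l ε : ℝ≥0) where
  /-- the encoder of block `n`, a function of the first `min n N` messages -/
  enc : (n : ℕ) → Messages M (min n N) → Block ch.T
  /-- the decoder after block `n`, which estimates the first `min n N` messages -/
  dec : (n : ℕ) → (Fin n → Output ch.T) → Messages M (min n N)
  /-- the stopping time `τ*`, as a function of what the receiver observes -/
  tauStar : (ℕ → Output ch.T) → ℕ∞
  one_le_tauStar : ∀ y, 1 ≤ tauStar y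
  /-- whether the receiver stops after block `n` depends on the blocks `1, …, n` only -/
  tauStar_adapted : ∀ (n : ℕ) (y y' : ℕ → Output ch.T), prefixOf y n = prefixOf y' n →
    tauStar y = n → tauStar y' = n
  /-- `E[τ*] ≤ l`, with equiprobable messages that are independent of the channel -/
  length_le :
    (∑ j : Messages M N,
      ∫⁻ w, (tauStar fun k => ch.out (enc k (restrict k j)) (w k) : ℝ≥0∞) ∂ch.pathLaw) /
        (Fintype.card (Messages M N) : ℝ≥0∞) ≤ l
  /-- the probability that the first `min τ* N` messages are not decoded correctly at time `τ*`
  is at most `ε` (a run that never terminates counts as an error) -/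
  error_le :
    (∑ j : Messages M N,
      ch.pathLaw {w | ¬ ∃ n : ℕ,
        tauStar (fun k => ch.out (enc k (restrict k j)) (w k)) = n ∧
        dec n (prefixOf (fun k => ch.out (enc k (restrict k j)) (w k)) n) = restrict n j}) /
        (Fintype.card (Messages M N) : ℝ≥0∞) ≤ ε

/-- What happens in one block: the input `X`, an independent copy of it, and the state and noise
word of the channel. -/
abbrev Sample (T : ℕ) : Type := Block T × Block T × (Bool × Block T)

namespace Channel

variable (ch : Channel)

/-- The joint law of the inputs `X`, their independent copies, the states and the noise words. -/
def sampleLaw : Measure (ℕ → Sample ch.T) :=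
  Measure.infinitePi fun _ => (inputLaw ch.T).prod ((inputLaw ch.T).prod ch.stateNoiseLaw)

/-- The inputs `X_k`. -/
def X (ω : ℕ → Sample ch.T) (k : ℕ) : Block ch.T := (ω k).1

/-- The independent copies of the inputs. -/
def Xbar (ω : ℕ → Sample ch.T) (k : ℕ) : Block ch.T := (ω k).2.1

/-- The outputs `Y_k` of the channel when `X_k` is its input (together with the states). -/
def Y (ω : ℕ → Sample ch.T) (k : ℕ) : Output ch.T := ch.out (ω k).1 (ω k).2.2

/-- The threshold `γ_1 + … + γ_k`. -/
def threshold (γ : ℕ → ℝ) (k : ℕ) : EReal := ((∑ i ∈ Finset.Icc 1 k, γ i : ℝ) : EReal)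

/-- The hitting time `τ = inf {k ≥ 1 : i(X_1^k ; Y_1^k) ≥ γ_1 + … + γ_k}`, infinite if there is
no such `k`. -/
def tau (γ : ℕ → ℝ) (ω : ℕ → Sample ch.T) : ℕ∞ :=
  ⨅ k : {k : ℕ // 1 ≤ k ∧
    threshold γ k ≤ ch.densityIcc (ch.X ω) (ch.Y ω) 1 k}, (k.1 : ℕ∞)

/-- The hitting time of the sum of `i(X_1^{n-1} ; Y_1^{n-1})` and `i(X̄_n^k ; Y_n^k)`, over
`k ≥ n`. -/
def tauBar (γ : ℕ → ℝ) (n : ℕ) (ω : ℕ → Sample ch.T) : ℕ∞ :=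
  ⨅ k : {k : ℕ // n ≤ k ∧
    threshold γ k ≤ ch.densityIcc (ch.X ω) (ch.Y ω) 1 (n - 1)
      + ch.densityIcc (ch.Xbar ω) (ch.Y ω) n k}, (k.1 : ℕ∞)

end Channel

/-- `min(t, N)` as a natural number. -/
def capped (N : ℕ) (t : ℕ∞) : ℕ := (min t (N : ℕ∞)).toNat

/-- `(M_n - 1) M_{n+1} ⋯ M_{min(t, N)}`, an empty product being one. -/
def Mtilde (N : ℕ) (M : ℕ → ℕ) (n : ℕ) (t : ℕ∞) : ℕ :=
  (M n - 1) * ∏ i ∈ Finset.Icc (n + 1) (capped N t), M i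

end

end EMS

/-! Random coding with independent uniform words: the receiver stops at the first block in which
some message tuple reaches the threshold, and outputs such a tuple. The transmitted tuple reaches it
at time τ, so for every codebook and every noise path the stopping time is at most τ
(`codeTau_le_noiseTau`).

The noise enters by XOR and the output word is uniform given the state, so an information density
depends only on the state, the noise and the XOR of the tested word with the sent one
(`density_out`). Hence τ is a function of states and noise alone, and the length bound holds for
each codebook separately. Only the error has to be averaged, and one codebook that is at least as
good as the average meets both bounds.

An error requires a wrong tuple that crosses no later than τ. If it is first wrong in block n, its
words agree with the sent ones before n, and from n on the XOR of the two is uniform and fresh, like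
that of X and X̄; given the noise, it crosses by τ with the probability of τ̄_n ≤ τ. Entries after
min(τ, N) play no role, so (M_n - 1) M_{n+1} ⋯ M_{min(τ,N)} tuples remain for the union bound
(`one_le_badCount`, `lintegral_codeLaw_badCount`).

A code needs finite l, so E[τ] = ∞ has to be dealt with. If the Bhattacharyya coefficient is below
one, τ has a geometric tail. Otherwise all densities vanish almost surely and τ is almost surely
constant; if that constant is ∞, a trivial one-block code suffices (`lintegral_noiseTau_lt_top_or`,
`exists_code_of_ae_eq_top`). -/

namespace EMS

/-! ### Infinite products of measures -/

theorem lintegral_infinitePi_prod {ι : Type*} {X : ι → Type*} [∀ i, MeasurableSpace (X i)]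
    (μ : (i : ι) → Measure (X i)) [∀ i, IsProbabilityMeasure (μ i)] (s : Finset ι)
    (f : (i : ι) → X i → ℝ≥0∞) (hf : ∀ i, Measurable (f i)) :
    ∫⁻ x, ∏ i ∈ s, f i (x i) ∂Measure.infinitePi μ = ∏ i ∈ s, ∫⁻ y, f i y ∂μ i := by
  have h := lintegral_prod_eq_prod_lintegral_of_indepFun (μ := Measure.infinitePi μ) s
    (fun i x => f i (x i)) (iIndepFun_infinitePi hf)
    (fun i => (hf i).comp (measurable_pi_apply i))
  rw [h]
  refine Finset.prod_congr rfl fun i _ => ?_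
  exact (measurePreserving_eval_infinitePi μ i).lintegral_comp (hf i)

/-- Both sides agree on boxes: slicing along the first component leaves an integrand that is a
product over the coordinates. This separates a sequence of pairs into two independent sequences. -/
theorem infinitePi_prod {ι : Type*} {X Y : ι → Type*} [∀ i, MeasurableSpace (X i)]
    [∀ i, MeasurableSpace (Y i)] (μ : (i : ι) → Measure (X i)) [∀ i, IsProbabilityMeasure (μ i)]
    (ν : (i : ι) → Measure (Y i)) [∀ i, IsProbabilityMeasure (ν i)] :
    Measure.infinitePi (fun i => (μ i).prod (ν i)) =
      ((Measure.infinitePi μ).prod (Measure.infinitePi ν)).map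
        (fun p i => (p.1 i, p.2 i)) := by
  symm
  have hz : Measurable (fun (p : (∀ i, X i) × (∀ i, Y i)) (i : ι) => (p.1 i, p.2 i)) := by
    fun_prop
  apply Measure.eq_infinitePi
  intro s t ht
  have hs : MeasurableSet (Set.pi (s : Set ι) t) :=
    MeasurableSet.pi s.countable_toSet fun i _ => ht i
  rw [Measure.map_apply hz hs, Measure.prod_apply (hz hs)]
  have : ∀ x : ∀ i, X i, Measure.infinitePi ν
      (Prod.mk x ⁻¹' ((fun (p : (∀ i, X i) × (∀ i, Y i)) (i : ι) => (p.1 i, p.2 i)) ⁻¹'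
        Set.pi (s : Set ι) t)) = ∏ i ∈ s, ν i (Prod.mk (x i) ⁻¹' t i) := by
    intro x
    rw [← Measure.infinitePi_pi ν (fun i _ => measurable_prodMk_left (ht i))]
    rfl
  simp_rw [this]
  rw [lintegral_infinitePi_prod μ s (fun i x => ν i (Prod.mk x ⁻¹' t i))
    (fun i => measurable_measure_prodMk_left (ht i))]
  exact Finset.prod_congr rfl fun i _ => (Measure.prod_apply (ht i)).symm

/-! ### The blockwise XOR and the input law -/

theorem bxor_assoc {T : ℕ} (x y z : Block T) : bxor (bxor x y) z = bxor x (bxor y z) := by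
  funext t; simp [bxor]

theorem bxor_comm {T : ℕ} (x y : Block T) : bxor x y = bxor y x := by
  funext t; simp [bxor, Bool.xor_comm]

theorem bxor_bxor_cancel {T : ℕ} (x y : Block T) : bxor x (bxor x y) = y := by
  funext t; simp [bxor]

theorem bxor_eq_iff {T : ℕ} (x y z : Block T) : bxor x y = z ↔ y = bxor x z := by
  constructor
  · rintro rfl; rw [bxor_bxor_cancel]
  · rintro rfl; rw [bxor_bxor_cancel]

theorem bxor_self {T : ℕ} (x : Block T) : bxor x x = fun _ => false := by
  funext t; simp [bxor]

theorem false_bxor {T : ℕ} (x : Block T) : bxor (fun _ => false) x = x := by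
  funext t; simp [bxor]

instance {T : ℕ} (p : unitInterval) : IsProbabilityMeasure (bernBlock T p) := by
  unfold bernBlock; infer_instance

instance {T : ℕ} : IsProbabilityMeasure (inputLaw T) := by
  unfold inputLaw; infer_instance

theorem inputLaw_singleton {T : ℕ} (x : Block T) : inputLaw T {x} = (2 ^ T)⁻¹ := by
  have h : ∀ b : Bool, bernoulliMeasure true false
      (⟨1 / 2, by norm_num, by norm_num⟩ : unitInterval) {b} = 2⁻¹ := by
    have h2 : ((unitInterval.toNNReal ⟨1 / 2, by norm_num, by norm_num⟩ : ℝ≥0) : ℝ≥0∞) = 2⁻¹ := by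
      rw [← ENNReal.coe_ofNat, ← ENNReal.coe_inv (by norm_num)]
      congr 1
      ext
      simp
    have h3 : ((unitInterval.toNNReal (unitInterval.symm ⟨1 / 2, by norm_num, by norm_num⟩) : ℝ≥0)
        : ℝ≥0∞) = 2⁻¹ := by
      rw [← ENNReal.coe_ofNat, ← ENNReal.coe_inv (by norm_num)]
      congr 1
      ext
      simp [unitInterval.symm]
      norm_num
    intro b
    cases b
    · rw [bernoulliMeasure_apply_of_notMem_of_mem _ (measurableSet_singleton _) (by simp) (by simp)]
      exact h3
    · rw [bernoulliMeasure_apply_of_mem_of_notMem _ (measurableSet_singleton _) (by simp) (by simp)]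
      exact h2
  unfold inputLaw bernBlock
  rw [Measure.pi_singleton]
  simp_rw [h]
  simp [ENNReal.inv_pow]

/-- XOR with a fixed word is a bijection, and all singletons have the same mass. -/
theorem inputLaw_map_bxor {T : ℕ} (x : Block T) : (inputLaw T).map (bxor x) = inputLaw T := by
  refine Measure.ext_of_singleton fun z => ?_
  rw [Measure.map_apply (measurable_of_countable _) (measurableSet_singleton _)]
  have : bxor x ⁻¹' {z} = {bxor x z} := by
    ext y; simp [bxor_eq_iff]
  rw [this, inputLaw_singleton, inputLaw_singleton]

theorem inputLaw_prod_map_bxor {T : ℕ} :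
    ((inputLaw T).prod (inputLaw T)).map (fun p => bxor p.1 p.2) = inputLaw T := by
  ext s hs
  rw [Measure.map_apply (measurable_of_countable _) hs,
    Measure.prod_apply (measurable_of_countable _ hs)]
  have : ∀ x : Block T, inputLaw T (Prod.mk x ⁻¹' ((fun p : Block T × Block T => bxor p.1 p.2) ⁻¹' s))
      = inputLaw T s := by
    intro x
    conv_rhs => rw [← inputLaw_map_bxor x]
    rw [Measure.map_apply (measurable_of_countable _) hs]
    rfl
  simp_rw [this]
  simp

/-- The XOR of two distinct entries of a codebook with independent uniform entries is uniform. -/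
theorem pi_inputLaw_map_bxor {T : ℕ} {ι : Type*} [Fintype ι] {a b : ι} (hab : a ≠ b) :
    (Measure.pi fun _ : ι => inputLaw T).map (fun c => bxor (c a) (c b)) = inputLaw T := by
  have hind : iIndepFun (fun (i : ι) (c : ι → Block T) => c i)
      (Measure.pi fun _ : ι => inputLaw T) :=
    iIndepFun_pi (X := fun _ x => x) fun _ => aemeasurable_id
  have h2 := (indepFun_iff_map_prod_eq_prod_map_map
    (measurable_pi_apply a).aemeasurable (measurable_pi_apply b).aemeasurable).1
      (hind.indepFun hab)
  have h3 : (Measure.pi fun _ : ι => inputLaw T).map (fun c => (c a, c b)) =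
      (inputLaw T).prod (inputLaw T) := by
    rw [h2, (measurePreserving_eval _ a).map_eq, (measurePreserving_eval _ b).map_eq]
  conv_rhs => rw [← inputLaw_prod_map_bxor, ← h3, Measure.map_map (measurable_of_countable _) (by fun_prop)]
  rfl

/-! ### Symmetry of the channel -/

namespace Channel

variable (ch : Channel)

instance : IsProbabilityMeasure ch.stateNoiseLaw := by
  have : IsProbabilityMeasure ((bernBlock ch.T (ch.δ true)).map (Prod.mk true)) :=
    Measure.isProbabilityMeasure_map measurable_prodMk_left.aemeasurable
  have : IsProbabilityMeasure ((bernBlock ch.T (ch.δ false)).map (Prod.mk false)) :=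
    Measure.isProbabilityMeasure_map measurable_prodMk_left.aemeasurable
  constructor
  simp only [stateNoiseLaw, Measure.coe_add, Pi.add_apply, Measure.smul_apply, measure_univ,
    ENNReal.smul_def, smul_eq_mul, mul_one]
  rw [← ENNReal.coe_add]
  norm_cast
  ext
  simp [unitInterval.symm]

instance : IsProbabilityMeasure ch.pathLaw := by
  unfold pathLaw; infer_instance

instance : IsProbabilityMeasure ch.sampleLaw := by
  unfold sampleLaw; infer_instance

theorem trans_eq (x : Block ch.T) (o : Output ch.T) :
    ch.trans x o = bernBlock ch.T (ch.δ o.1) {bxor x o.2} := by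
  simp only [trans, bxor_eq_iff, Set.ofPred_eq_eq_singleton]

theorem outProb_eq (o : Output ch.T) : ch.outProb o = (2 ^ ch.T)⁻¹ := by
  unfold outProb
  rw [lintegral_fintype]
  simp_rw [inputLaw_singleton, ← Finset.sum_mul, trans_eq]
  have e : Function.Bijective (fun x : Block ch.T => bxor x o.2) := by
    refine Function.Involutive.bijective fun x => ?_
    rw [bxor_comm, bxor_comm x, bxor_bxor_cancel]
  rw [e.sum_comp (fun z => bernBlock ch.T (ch.δ o.1) {z})]
  simp [sum_measure_singleton]

/-- The channel is symmetric: the information density of a word and an output depends on the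
XOR of the word with the input, and on the state and the noise only. -/
theorem density_out (x x' : Block ch.T) (w : Bool × Block ch.T) :
    ch.density x (ch.out x' w) = ch.density (bxor x' x) w := by
  unfold density
  rw [outProb_eq, outProb_eq, trans_eq, trans_eq]
  simp only [out]
  rw [bxor_comm x' x, bxor_assoc]

end Channel

/-! ### First hitting times -/

theorem iInf_hit_le_iff {P : ℕ → Prop} {m : ℕ} :
    (⨅ k : {k : ℕ // P k}, (k.1 : ℕ∞)) ≤ m ↔ ∃ k, P k ∧ k ≤ m := by
  constructor
  · intro h
    by_contra! hc
    have : ((m + 1 : ℕ) : ℕ∞) ≤ ⨅ k : {k : ℕ // P k}, (k.1 : ℕ∞) :=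
      le_iInf fun k => by exact_mod_cast hc k.1 k.2
    have := this.trans h
    norm_cast at this
    omega
  · rintro ⟨k, hk, hkm⟩
    exact (iInf_le _ (⟨k, hk⟩ : {k : ℕ // P k})).trans (by exact_mod_cast hkm)

theorem iInf_hit_congr {P Q : ℕ → Prop} (h : ∀ k, P k ↔ Q k) :
    (⨅ k : {k : ℕ // P k}, (k.1 : ℕ∞)) = ⨅ k : {k : ℕ // Q k}, (k.1 : ℕ∞) := by
  obtain rfl : P = Q := funext fun k => propext (h k)
  rfl

theorem iInf_hit_eq_iff {P : ℕ → Prop} {m : ℕ} :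
    (⨅ k : {k : ℕ // P k}, (k.1 : ℕ∞)) = m ↔ P m ∧ ∀ k < m, ¬ P k := by
  constructor
  · intro h
    have h1 : ∀ k < m, ¬ P k := fun k hk hP => by
      have := iInf_le (fun k : {k : ℕ // P k} => (k.1 : ℕ∞)) ⟨k, hP⟩
      rw [h] at this
      have : m ≤ k := by exact_mod_cast this
      omega
    obtain ⟨k, hk, hkm⟩ := iInf_hit_le_iff.1 h.le
    obtain rfl : k = m := by
      by_contra hne
      exact h1 k (by omega) hk
    exact ⟨hk, h1⟩
  · rintro ⟨hP, h⟩
    refine le_antisymm (iInf_hit_le_iff.2 ⟨m, hP, le_rfl⟩) (le_iInf fun k => ?_)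
    have : ¬ k.1 < m := fun hk => h _ hk k.2
    exact_mod_cast not_lt.1 this

theorem iInf_hit_eq_top_iff {P : ℕ → Prop} :
    (⨅ k : {k : ℕ // P k}, (k.1 : ℕ∞)) = ⊤ ↔ ∀ k, ¬ P k := by
  simp [iInf_eq_top]

theorem measurable_iInf_hit {Ω : Type*} [MeasurableSpace Ω] {P : Ω → ℕ → Prop}
    (hP : ∀ k, MeasurableSet {ω | P ω k}) :
    Measurable fun ω => ⨅ k : {k : ℕ // P ω k}, (k.1 : ℕ∞) := by
  refine measurable_to_countable' fun m => ?_
  induction m using ENat.recTopCoe with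
  | top =>
    have : (fun ω => ⨅ k : {k : ℕ // P ω k}, (k.1 : ℕ∞)) ⁻¹' {⊤} = ⋂ k, {ω | P ω k}ᶜ := by
      ext ω
      simp only [Set.mem_preimage, Set.mem_singleton_iff, iInf_hit_eq_top_iff, Set.mem_iInter]
      rfl
    rw [this]
    exact MeasurableSet.iInter fun k => (hP k).compl
  | coe m =>
    have : (fun ω => ⨅ k : {k : ℕ // P ω k}, (k.1 : ℕ∞)) ⁻¹' {(m : ℕ∞)} =
        {ω | P ω m} ∩ ⋂ k : Fin m, {ω | P ω k}ᶜ := by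
      ext ω
      simp only [Set.mem_preimage, Set.mem_singleton_iff, iInf_hit_eq_iff, Set.mem_inter_iff,
        Set.mem_iInter, Fin.forall_iff]
      rfl
    rw [this]
    exact (hP m).inter (MeasurableSet.iInter fun k => (hP k).compl)

theorem measurable_apply₂ {Ω A B C : Type*} [MeasurableSpace Ω] [MeasurableSpace A]
    [MeasurableSpace B] [MeasurableSpace C] {f : A → B → C}
    (hf : Measurable (Function.uncurry f)) {x : Ω → A} (hx : Measurable x) {y : Ω → B}
    (hy : Measurable y) : Measurable fun ω => f (x ω) (y ω) := by
  have h := hx.prodMk hy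
  exact hf.comp h

/-! ### The hitting times in terms of the noise -/

namespace Channel

variable (ch : Channel)

/-- The hitting time `τ` as a function of the states and noise words. -/
noncomputable def noiseTau (γ : ℕ → ℝ) (w : ℕ → Bool × Block ch.T) : ℕ∞ :=
  ⨅ k : {k : ℕ // 1 ≤ k ∧
    threshold γ k ≤ ch.densityIcc (fun _ _ => false) w 1 k}, (k.1 : ℕ∞)

/-- The hitting time `τ̄_n` as a function of the states and noise words, and of the XOR `d` of the
channel inputs and their copies. -/
noncomputable def noiseTauBar (γ : ℕ → ℝ) (n : ℕ) (d : ℕ → Block ch.T)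
    (w : ℕ → Bool × Block ch.T) : ℕ∞ :=
  ⨅ k : {k : ℕ // n ≤ k ∧
    threshold γ k ≤ ch.densityIcc (fun _ _ => false) w 1 (n - 1) + ch.densityIcc d w n k},
      (k.1 : ℕ∞)

theorem densityIcc_out (x x' : ℕ → Block ch.T) (w : ℕ → Bool × Block ch.T) (a b : ℕ) :
    ch.densityIcc x (fun k => ch.out (x' k) (w k)) a b =
      ch.densityIcc (fun k => bxor (x' k) (x k)) w a b := by
  simp only [densityIcc, density_out]

theorem densityIcc_congr {x x' : ℕ → Block ch.T} {y y' : ℕ → Output ch.T} {a b : ℕ}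
    (hx : ∀ k ∈ Finset.Icc a b, x k = x' k) (hy : ∀ k ∈ Finset.Icc a b, y k = y' k) :
    ch.densityIcc x y a b = ch.densityIcc x' y' a b :=
  Finset.sum_congr rfl fun k hk => by rw [hx k hk, hy k hk]

theorem densityIcc_add (x : ℕ → Block ch.T) (y : ℕ → Output ch.T) {n k : ℕ} (hn : 1 ≤ n)
    (hk : n ≤ k) :
    ch.densityIcc x y 1 (n - 1) + ch.densityIcc x y n k = ch.densityIcc x y 1 k := by
  unfold densityIcc
  obtain ⟨m, rfl⟩ : ∃ m, n = m + 1 := ⟨n - 1, by omega⟩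
  have h : ∀ a b : ℕ, Finset.Icc a b = Finset.Ico a (b + 1) := fun a b => by
    ext; rw [Finset.mem_Icc, Finset.mem_Ico]; omega
  rw [h, h, h]
  exact Finset.sum_Ico_consecutive _ (by omega) (by omega)

/-- The transmitted word has XOR zero with itself, so the inputs drop out. -/
theorem tau_eq (γ : ℕ → ℝ) (ω : ℕ → Sample ch.T) :
    ch.tau γ ω = ch.noiseTau γ fun k => (ω k).2.2 := by
  have h : ∀ k, ch.densityIcc (ch.X ω) (ch.Y ω) 1 k =
      ch.densityIcc (fun _ _ => false) (fun k => (ω k).2.2) 1 k := fun k => by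
    rw [show ch.Y ω = fun k => ch.out (ch.X ω k) (ω k).2.2 from rfl, densityIcc_out]
    simp only [bxor_self]
  exact iInf_hit_congr fun k => by rw [h]

theorem tauBar_eq (γ : ℕ → ℝ) (n : ℕ) (ω : ℕ → Sample ch.T) :
    ch.tauBar γ n ω =
      ch.noiseTauBar γ n (fun k => bxor (ω k).1 (ω k).2.1) fun k => (ω k).2.2 := by
  have h1 : ∀ a k, ch.densityIcc (ch.X ω) (ch.Y ω) a k =
      ch.densityIcc (fun _ _ => false) (fun k => (ω k).2.2) a k := fun a k => by
    rw [show ch.Y ω = fun k => ch.out (ch.X ω k) (ω k).2.2 from rfl, densityIcc_out]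
    simp only [bxor_self]
  have h2 : ∀ a k, ch.densityIcc (ch.Xbar ω) (ch.Y ω) a k =
      ch.densityIcc (fun k => bxor (ω k).1 (ω k).2.1) (fun k => (ω k).2.2) a k := fun a k => by
    rw [show ch.Y ω = fun k => ch.out (ch.X ω k) (ω k).2.2 from rfl, densityIcc_out]
    rfl
  exact iInf_hit_congr fun k => by rw [h1, h2]

/-- Allows the codeword differences, which vanish before block `n`, to be exchanged for a fully
uniform sequence. -/
theorem noiseTauBar_congr (γ : ℕ → ℝ) {n : ℕ} {d d' : ℕ → Block ch.T}
    (h : ∀ k, n ≤ k → d k = d' k) (w : ℕ → Bool × Block ch.T) :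
    ch.noiseTauBar γ n d w = ch.noiseTauBar γ n d' w := by
  have h' : ∀ k, ch.densityIcc d w n k = ch.densityIcc d' w n k := fun k =>
    ch.densityIcc_congr (fun i hi => h i (Finset.mem_Icc.1 hi).1) fun _ _ => rfl
  exact iInf_hit_congr fun k => by rw [h']

theorem measurable_densityIcc {Ω : Type*} [MeasurableSpace Ω] {x : Ω → ℕ → Block ch.T}
    (hx : Measurable x) {y : Ω → ℕ → Output ch.T} (hy : Measurable y) (a b : ℕ) :
    Measurable fun ω => ch.densityIcc (x ω) (y ω) a b := by
  simp only [densityIcc]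
  exact Finset.measurable_fun_sum _ fun k _ =>
    measurable_apply₂ (f := ch.density) (measurable_of_countable _)
      (measurable_pi_iff.1 hx k) (measurable_pi_iff.1 hy k)

theorem measurable_noiseTau (γ : ℕ → ℝ) : Measurable (ch.noiseTau γ) := by
  refine measurable_iInf_hit fun k => ?_
  exact (MeasurableSet.const _).inter (measurableSet_le measurable_const
    (ch.measurable_densityIcc measurable_const measurable_id 1 k))

theorem measurable_noiseTauBar (γ : ℕ → ℝ) (n : ℕ) :
    Measurable fun p : (ℕ → Block ch.T) × (ℕ → Bool × Block ch.T) =>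
      ch.noiseTauBar γ n p.1 p.2 := by
  refine measurable_iInf_hit fun k => ?_
  exact (MeasurableSet.const _).inter (measurableSet_le measurable_const
    ((ch.measurable_densityIcc measurable_const measurable_snd 1 (n - 1)).add
      (ch.measurable_densityIcc measurable_fst measurable_snd n k)))

/-! ### The laws of the XOR of the inputs and of the noise -/

/-- The law of a sequence of independent uniform blocks. -/
noncomputable def diffLaw : Measure (ℕ → Block ch.T) :=
  Measure.infinitePi fun _ => inputLaw ch.T

instance : IsProbabilityMeasure ch.diffLaw := by
  unfold diffLaw; infer_instance

/-- The one-time pad: the XOR with an independent uniform copy is uniform, and it stays independent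
of state and noise. -/
theorem map_sample_diff :
    ((inputLaw ch.T).prod ((inputLaw ch.T).prod ch.stateNoiseLaw)).map
      (fun s : Sample ch.T => (bxor s.1 s.2.1, s.2.2)) = (inputLaw ch.T).prod ch.stateNoiseLaw := by
  conv_rhs => rw [← inputLaw_prod_map_bxor, ← Measure.map_id (μ := ch.stateNoiseLaw)]
  rw [Measure.map_prod_map _ _ (measurable_of_countable _) measurable_id,
    ← Measure.prodAssoc_prod, Measure.map_map (measurable_of_countable _) (by fun_prop)]
  rfl

theorem lintegral_sampleLaw {F : (ℕ → Block ch.T) × (ℕ → Bool × Block ch.T) → ℝ≥0∞}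
    (hF : Measurable F) :
    ∫⁻ ω, F (fun k => bxor (ω k).1 (ω k).2.1, fun k => (ω k).2.2) ∂ch.sampleLaw =
      ∫⁻ p, F p ∂ch.diffLaw.prod ch.pathLaw := by
  have h1 : ch.sampleLaw.map (fun ω k => (bxor (ω k).1 (ω k).2.1, (ω k).2.2)) =
      (ch.diffLaw.prod ch.pathLaw).map (fun p k => (p.1 k, p.2 k)) := by
    have := Measure.infinitePi_map_pi
      (μ := fun _ : ℕ => (inputLaw ch.T).prod ((inputLaw ch.T).prod ch.stateNoiseLaw))
      (f := fun _ (s : Sample ch.T) => (bxor s.1 s.2.1, s.2.2))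
      (fun _ => measurable_of_countable _)
    rw [sampleLaw, this]
    simp_rw [map_sample_diff]
    exact infinitePi_prod _ _
  have hu : Measurable fun (s : ℕ → Block ch.T × (Bool × Block ch.T)) =>
      ((fun k => (s k).1 : ℕ → Block ch.T), (fun k => (s k).2 : ℕ → Bool × Block ch.T)) := by
    fun_prop
  have hb : Measurable fun s : Sample ch.T => (bxor s.1 s.2.1, s.2.2) :=
    measurable_of_countable _
  have hm1 : Measurable fun (ω : ℕ → Sample ch.T) (k : ℕ) =>
      (bxor (ω k).1 (ω k).2.1, (ω k).2.2) :=
    measurable_pi_lambda _ fun k => hb.comp (measurable_pi_apply k)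
  have hm2 : Measurable fun (p : (ℕ → Block ch.T) × (ℕ → Bool × Block ch.T)) (k : ℕ) =>
      (p.1 k, p.2 k) := by fun_prop
  have e1 := lintegral_map (μ := ch.sampleLaw) (hF.comp hu) hm1
  have e2 := lintegral_map (μ := ch.diffLaw.prod ch.pathLaw) (hF.comp hu) hm2
  rw [h1] at e1
  exact e1.symm.trans e2

end Channel

/-! ### Finiteness of the expected hitting time -/

theorem two_mul_le_one_add_sq (x : ℝ≥0∞) : 2 * x ≤ 1 + x ^ 2 := by
  induction x using ENNReal.recTopCoe with
  | top => simp
  | coe x =>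
    norm_cast
    have := two_mul_le_add_sq 1 x
    simpa using this

theorem two_mul_lt_one_add_sq {x : ℝ≥0∞} (hx : x ≠ ⊤) (hx1 : x ≠ 1) : 2 * x < 1 + x ^ 2 := by
  refine lt_of_le_of_ne (two_mul_le_one_add_sq x) fun h => hx1 ?_
  lift x to ℝ≥0 using hx
  norm_cast at h ⊢
  have h' : (2 * x : ℝ) = 1 + x ^ 2 := by exact_mod_cast h
  have : ((x : ℝ) - 1) ^ 2 = 0 := by linarith
  have : (x : ℝ) = 1 := by linarith [pow_eq_zero_iff (two_ne_zero) |>.1 this]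
  exact_mod_cast this

theorem coe_eq_tsum_ite_lt (t : ℕ∞) : (t : ℝ≥0∞) = ∑' n : ℕ, if (n : ℕ∞) < t then 1 else 0 := by
  induction t using ENat.recTopCoe with
  | top => simp
  | coe m =>
    rw [tsum_eq_sum (s := Finset.range m)]
    · rw [Finset.sum_congr rfl (g := fun _ => (1 : ℝ≥0∞))]
      · simp
      · intro n hn
        rw [if_pos]
        exact_mod_cast Finset.mem_range.1 hn
    · intro n hn
      rw [if_neg]
      simpa using hn

theorem lintegral_coe_eq_tsum {Ω : Type*} [MeasurableSpace Ω] (μ : Measure Ω) {t : Ω → ℕ∞}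
    (ht : Measurable t) :
    ∫⁻ ω, (t ω : ℝ≥0∞) ∂μ = ∑' n : ℕ, μ {ω | (n : ℕ∞) < t ω} := by
  simp_rw [coe_eq_tsum_ite_lt]
  have hm : ∀ n : ℕ, MeasurableSet {ω | (n : ℕ∞) < t ω} := fun n =>
    ht (MeasurableSet.of_discrete (s := Set.Ioi (n : ℕ∞)))
  rw [lintegral_tsum fun n => (Measurable.ite (hm n) measurable_const measurable_const).aemeasurable]
  refine tsum_congr fun n => ?_
  rw [← lintegral_indicator_one (hm n)]
  refine lintegral_congr fun ω => ?_
  simp only [Set.indicator_apply, Set.mem_ofPred_eq, Pi.one_apply]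

/-- The thresholds take finitely many values, so the prefactors of the tail bound for τ have a
common finite bound. -/
theorem threshold_eq_of_le {γ : ℕ → ℝ} {N n : ℕ} (hγ : ∀ n, N < n → γ n = 0) (hn : N ≤ n) :
    Channel.threshold γ n = Channel.threshold γ N := by
  unfold Channel.threshold
  congr 1
  symm
  refine Finset.sum_subset (Finset.Icc_subset_Icc le_rfl hn) fun i hi hi' => hγ i ?_
  simp only [Finset.mem_Icc] at hi hi'
  omega

namespace Channel

variable (ch : Channel)

/-- The likelihood ratio `P(y | x, s) / P(y | s)` of the transmitted word, as a function of the
state and the noise. -/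
noncomputable def likelihood (w : Bool × Block ch.T) : ℝ≥0∞ :=
  ch.trans (fun _ => false) w / ch.outProb w

theorem likelihood_ne_top (w : Bool × Block ch.T) : ch.likelihood w ≠ ⊤ := by
  unfold likelihood
  rw [outProb_eq]
  refine ENNReal.div_ne_top (measure_ne_top _ _) ?_
  simp

theorem densityIcc_noise (w : ℕ → Bool × Block ch.T) (a b : ℕ) :
    ch.densityIcc (fun _ _ => false) w a b =
      ENNReal.log (∏ k ∈ Finset.Icc a b, ch.likelihood (w k)) := by
  unfold densityIcc
  induction Finset.Icc a b using Finset.induction_on with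
  | empty => simp
  | insert k s hk ih =>
    rw [Finset.sum_insert hk, Finset.prod_insert hk, ENNReal.log_mul_add, ih]
    rfl

theorem lintegral_stateNoiseLaw (f : Bool × Block ch.T → ℝ≥0∞) :
    ∫⁻ w, f w ∂ch.stateNoiseLaw =
      unitInterval.toNNReal ch.q * ∫⁻ z, f (true, z) ∂bernBlock ch.T (ch.δ true) +
      unitInterval.toNNReal (unitInterval.symm ch.q) *
        ∫⁻ z, f (false, z) ∂bernBlock ch.T (ch.δ false) := by
  rw [stateNoiseLaw, lintegral_add_measure, lintegral_smul_measure, lintegral_smul_measure,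
    lintegral_map (measurable_of_countable _) measurable_prodMk_left,
    lintegral_map (measurable_of_countable _) measurable_prodMk_left]
  rfl

/-- The weight of a noise word cancels against its likelihood, leaving the uniform mass. Equality
can fail, since words of probability zero contribute nothing. -/
theorem lintegral_inv_likelihood_le_one : ∫⁻ w, (ch.likelihood w)⁻¹ ∂ch.stateNoiseLaw ≤ 1 := by
  have key : ∀ s, ∫⁻ z, (ch.likelihood (s, z))⁻¹ ∂bernBlock ch.T (ch.δ s) ≤ 1 := by
    intro s
    rw [lintegral_fintype]
    calc ∑ z, (ch.likelihood (s, z))⁻¹ * bernBlock ch.T (ch.δ s) {z}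
        ≤ ∑ _z : Block ch.T, (2 ^ ch.T)⁻¹ := by
          refine Finset.sum_le_sum fun z _ => ?_
          rw [likelihood, outProb_eq, trans_eq, false_bxor]
          rw [ENNReal.inv_div (Or.inl (by simp)) (Or.inl (by simp)), mul_comm]
          exact ENNReal.mul_div_le
      _ = 1 := by
          rw [Finset.sum_const, Finset.card_univ, nsmul_eq_mul]
          simp only [Fintype.card_pi, Fintype.card_bool, Finset.prod_const, Finset.card_univ,
            Fintype.card_fin]
          push_cast
          exact ENNReal.mul_inv_cancel (by simp) (by simp)
  rw [lintegral_stateNoiseLaw]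
  calc _ ≤ (unitInterval.toNNReal ch.q : ℝ≥0∞) * 1 +
        (unitInterval.toNNReal (unitInterval.symm ch.q) : ℝ≥0∞) * 1 := by
        gcongr
        · exact key true
        · exact key false
    _ = 1 := by
        rw [mul_one, mul_one, ← ENNReal.coe_add]
        norm_cast
        ext
        simp [unitInterval.symm]

/-- The Bhattacharyya coefficient of the channel is less than one unless the output is
independent of the input. -/
theorem lintegral_rpow_likelihood_lt_one
    (h : ¬ ∀ᵐ w ∂ch.stateNoiseLaw, ch.likelihood w = 1) :
    ∫⁻ w, ch.likelihood w ^ (-1 / 2 : ℝ) ∂ch.stateNoiseLaw < 1 := by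
  -- With x the power -1/2 of the likelihood, the mean of 1 + x² is at most 2, and 2x ≤ 1 + x² is
  -- strict wherever the finite value x differs from 1.
  have hsq : ∀ w, (ch.likelihood w ^ (-1 / 2 : ℝ)) ^ 2 = (ch.likelihood w)⁻¹ := fun w => by
    rw [← ENNReal.rpow_natCast, ← ENNReal.rpow_mul, ← ENNReal.rpow_neg_one]
    norm_num
  have hle : ∫⁻ w, 1 + (ch.likelihood w)⁻¹ ∂ch.stateNoiseLaw ≤ 2 := by
    rw [lintegral_add_left measurable_const]
    simp only [lintegral_const, measure_univ, mul_one]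
    calc (1 : ℝ≥0∞) + _ ≤ 1 + 1 := by gcongr; exact ch.lintegral_inv_likelihood_le_one
      _ = 2 := by norm_num
  have hlt : ∫⁻ w, 2 * ch.likelihood w ^ (-1 / 2 : ℝ) ∂ch.stateNoiseLaw <
      ∫⁻ w, 1 + (ch.likelihood w)⁻¹ ∂ch.stateNoiseLaw := by
    have hpt : ∀ w, 2 * ch.likelihood w ^ (-1 / 2 : ℝ) ≤ 1 + (ch.likelihood w)⁻¹ := fun w => by
      rw [← hsq]; exact two_mul_le_one_add_sq _
    refine lintegral_strict_mono_of_ae_le_of_frequently_ae_lt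
      (measurable_of_countable _).aemeasurable ?_ (Filter.Eventually.of_forall hpt) ?_
    · exact ((lintegral_mono hpt).trans_lt (hle.trans_lt (by simp))).ne
    · have hfin : ∀ᵐ w ∂ch.stateNoiseLaw, (ch.likelihood w)⁻¹ < ⊤ :=
        ae_lt_top (measurable_of_countable _)
          (ch.lintegral_inv_likelihood_le_one.trans_lt (by simp)).ne
      refine (Filter.Frequently.and_eventually (Filter.not_eventually.1 h) hfin).mono ?_
      rintro w ⟨h1, h2⟩
      rw [← hsq]
      rw [← hsq] at h2
      refine (two_mul_lt_one_add_sq (x := ch.likelihood w ^ (-1 / 2 : ℝ))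
        (fun ht => by rw [ht] at h2; simp at h2) fun ht => h1 ?_).ne
      have := hsq w
      rw [ht, one_pow] at this
      rw [← inv_inv (ch.likelihood w), ← this, inv_one]
  rw [lintegral_const_mul _ (measurable_of_countable _)] at hlt
  by_contra! hc
  have : (2 : ℝ≥0∞) ≤ 2 * ∫⁻ w, ch.likelihood w ^ (-1 / 2 : ℝ) ∂ch.stateNoiseLaw := by
    calc (2 : ℝ≥0∞) = 2 * 1 := by norm_num
      _ ≤ _ := by gcongr
  exact absurd (this.trans_lt (hlt.trans_le hle)) (lt_irrefl _)

/-- A Chernoff bound with exponent -1/2: if τ exceeds `n`, the likelihood product is at most the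
exponential of the threshold. Markov's inequality and independence then give an `n`-th power. -/
theorem measure_lt_noiseTau_le (γ : ℕ → ℝ) (n : ℕ) :
    ch.pathLaw {w | (n : ℕ∞) < ch.noiseTau γ w} ≤
      ((EReal.exp (threshold γ n)) ^ (-1 / 2 : ℝ))⁻¹ *
        (∫⁻ w, ch.likelihood w ^ (-1 / 2 : ℝ) ∂ch.stateNoiseLaw) ^ n := by
  set c := (EReal.exp (threshold γ n)) ^ (-1 / 2 : ℝ) with hc
  have he0 : EReal.exp (threshold γ n) ≠ 0 := by simp [threshold, -EReal.exp_coe]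
  have het : EReal.exp (threshold γ n) ≠ ⊤ := by simp [threshold, -EReal.exp_coe]
  have hc0 : c ≠ 0 := by simp [hc, he0, het]
  have hct : c ≠ ⊤ := by simp [hc, he0, het]
  have hsub : {w | (n : ℕ∞) < ch.noiseTau γ w} ⊆
      {w | c ≤ ∏ k ∈ Finset.Icc 1 n, ch.likelihood (w k) ^ (-1 / 2 : ℝ)} := by
    intro w hw
    simp only [Set.mem_ofPred_eq] at hw ⊢
    rw [ENNReal.prod_rpow_of_ne_top fun i _ => ch.likelihood_ne_top _, hc]
    have hle : ∏ k ∈ Finset.Icc 1 n, ch.likelihood (w k) ≤ EReal.exp (threshold γ n) := by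
      -- Block 0 is not tested by τ; there the empty product equals the exponential of the empty
      -- sum.
      rcases Nat.eq_zero_or_pos n with rfl | hn
      · simp [threshold]
      · have : ¬ threshold γ n ≤ ch.densityIcc (fun _ _ => false) w 1 n := fun hle =>
          absurd (iInf_hit_le_iff.2 ⟨n, ⟨hn, hle⟩, le_rfl⟩) (not_le.2 hw)
        rw [densityIcc_noise, not_le] at this
        rw [← ENNReal.exp_log (∏ k ∈ Finset.Icc 1 n, ch.likelihood (w k))]
        exact EReal.exp_monotone this.le
    rw [neg_div, ENNReal.rpow_neg, ENNReal.rpow_neg, ENNReal.inv_le_inv]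
    exact ENNReal.rpow_le_rpow hle (by norm_num)
  have hmark : c * ch.pathLaw {w | c ≤ ∏ k ∈ Finset.Icc 1 n, ch.likelihood (w k) ^ (-1 / 2 : ℝ)} ≤
      (∫⁻ w, ch.likelihood w ^ (-1 / 2 : ℝ) ∂ch.stateNoiseLaw) ^ n := by
    have hm : ∀ k : ℕ, Measurable fun w : ℕ → Bool × Block ch.T =>
        ch.likelihood (w k) ^ (-1 / 2 : ℝ) := fun k =>
      (measurable_of_countable fun v => ch.likelihood v ^ (-1 / 2 : ℝ)).comp
        (measurable_pi_apply k)
    refine (mul_meas_ge_le_lintegral (Finset.measurable_fun_prod _ fun k _ => hm k) c).trans ?_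
    rw [pathLaw, lintegral_infinitePi_prod (fun _ : ℕ => ch.stateNoiseLaw) (Finset.Icc 1 n)
      (fun _ v => ch.likelihood v ^ (-1 / 2 : ℝ)) (fun _ => measurable_of_countable _)]
    simp
  calc _ ≤ ch.pathLaw {w | c ≤ ∏ k ∈ Finset.Icc 1 n, ch.likelihood (w k) ^ (-1 / 2 : ℝ)} :=
        measure_mono hsub
    _ = c⁻¹ * (c * ch.pathLaw
        {w | c ≤ ∏ k ∈ Finset.Icc 1 n, ch.likelihood (w k) ^ (-1 / 2 : ℝ)}) := by
        rw [← mul_assoc, ENNReal.inv_mul_cancel hc0 hct, one_mul]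
    _ ≤ _ := by gcongr

theorem lintegral_noiseTau_lt_top_or (γ : ℕ → ℝ) {N : ℕ} (hγ : ∀ n, N < n → γ n = 0) :
    ∫⁻ w, (ch.noiseTau γ w : ℝ≥0∞) ∂ch.pathLaw < ⊤ ∨
      ∀ᵐ w ∂ch.pathLaw, ch.noiseTau γ w = ⊤ := by
  by_cases h : ∀ᵐ w ∂ch.stateNoiseLaw, ch.likelihood w = 1
  -- All densities are almost surely zero here, so τ is the first block whose threshold is
  -- nonpositive.
  · set t : ℕ∞ := ⨅ k : {k : ℕ // 1 ≤ k ∧ threshold γ k ≤ 0}, (k.1 : ℕ∞) with ht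
    have hae : ∀ᵐ w ∂ch.pathLaw, ch.noiseTau γ w = t := by
      have : ∀ᵐ w ∂ch.pathLaw, ∀ k, ch.likelihood (w k) = 1 :=
        ae_all_iff.2 fun k => (measurePreserving_eval_infinitePi
          (fun _ : ℕ => ch.stateNoiseLaw) k).quasiMeasurePreserving.ae h
      filter_upwards [this] with w hw
      refine iInf_hit_congr fun k => ?_
      rw [densityIcc_noise]
      simp [hw]
    by_cases htop : t = ⊤
    · right
      filter_upwards [hae] with w hw
      rw [hw, htop]
    · left
      rw [lintegral_congr_ae (hae.mono fun w hw => by rw [hw])]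
      simpa [lt_top_iff_ne_top] using htop
  · left
    have hρ := ch.lintegral_rpow_likelihood_lt_one h
    set ρ := ∫⁻ w, ch.likelihood w ^ (-1 / 2 : ℝ) ∂ch.stateNoiseLaw
    set c : ℕ → ℝ≥0∞ := fun n => ((EReal.exp (threshold γ n)) ^ (-1 / 2 : ℝ))⁻¹ with hc
    set C := ∑ n ∈ Finset.range (N + 1), c n with hC
    have hcC : ∀ n, c n ≤ C := fun n => by
      have : c n = c (min n N) := by
        rcases le_total n N with h | h
        · rw [min_eq_left h]
        · rw [min_eq_right h]
          simp only [hc, threshold_eq_of_le hγ h]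
      rw [this]
      exact Finset.single_le_sum (f := c) (fun _ _ => zero_le) (Finset.mem_range.2 (by omega))
    have hCt : C < ⊤ := by
      refine ENNReal.sum_lt_top.2 fun n _ => lt_top_iff_ne_top.2 ?_
      have he0 : EReal.exp (threshold γ n) ≠ 0 := by simp [threshold, -EReal.exp_coe]
      have het : EReal.exp (threshold γ n) ≠ ⊤ := by simp [threshold, -EReal.exp_coe]
      simp [hc, he0, het]
    rw [lintegral_coe_eq_tsum _ (ch.measurable_noiseTau γ)]
    calc _ ≤ ∑' n, C * ρ ^ n := ENNReal.tsum_le_tsum fun n =>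
          (ch.measure_lt_noiseTau_le γ n).trans (by gcongr; exact hcC n)
      _ = C * (1 - ρ)⁻¹ := by rw [ENNReal.tsum_mul_left, ENNReal.tsum_geometric]
      _ < ⊤ := ENNReal.mul_lt_top hCt (ENNReal.inv_lt_top.2 (tsub_pos_of_lt hρ))

end Channel

/-! ### Messages -/

theorem restrict_eq_iff {M : ℕ → ℕ} {N : ℕ} (n : ℕ) (j j' : Messages M N) :
    restrict n j = restrict n j' ↔ ∀ i : Fin N, i.1 < n → j i = j' i := by
  constructor
  · intro h i hi
    exact congrFun h ⟨i.1, lt_min hi i.2⟩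
  · intro h
    funext i
    exact h _ (lt_of_lt_of_le i.2 (min_le_left _ _))

/-- The messages that differ from `j` in block `n` for the first time, and agree with it again
after block `t`. -/
def altMessages {M : ℕ → ℕ} {N : ℕ} (j : Messages M N) (n t : ℕ) : Finset (Messages M N) :=
  Fintype.piFinset fun i =>
    if i.1 + 1 < n then {j i} else if i.1 + 1 = n then {j i}ᶜ
      else if i.1 + 1 ≤ t then Finset.univ else {j i}

/-- One choice in each frozen block, `M n - 1` in block `n`, and all of them in the blocks `n + 1,
…, t`. -/
theorem card_altMessages {M : ℕ → ℕ} {N : ℕ} (j : Messages M N) {n t : ℕ} (hn : 1 ≤ n)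
    (hnt : n ≤ t) (ht : t ≤ N) :
    (altMessages j n t).card = (M n - 1) * ∏ i ∈ Finset.Icc (n + 1) t, M i := by
  -- The number of choices per block, defined on all of ℕ so that the product over `Fin N` can be
  -- shifted to block numbers.
  set g : ℕ → ℕ := fun m =>
    if m < n then 1 else if m = n then M m - 1 else if m ≤ t then M m else 1 with hg
  have h1 : (altMessages j n t).card = ∏ i : Fin N, g (i.1 + 1) := by
    unfold altMessages
    rw [Fintype.card_piFinset]
    refine Finset.prod_congr rfl fun i _ => ?_
    simp only [hg]
    split_ifs <;> simp [Finset.card_compl]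
  rw [h1, Fin.prod_univ_eq_prod_range (fun i => g (i + 1)) N, Finset.range_eq_Ico,
    Finset.prod_Ico_add' g 0 N 1,
    ← Finset.prod_subset (s₁ := insert n (Finset.Icc (n + 1) t)), Finset.prod_insert (by simp)]
  · congr 1
    · simp [hg]
    · refine Finset.prod_congr rfl fun i hi => ?_
      rw [Finset.mem_Icc] at hi
      simp only [hg]
      rw [if_neg (by omega), if_neg (by omega), if_pos hi.2]
  · intro i hi
    simp only [Finset.mem_insert, Finset.mem_Icc, Finset.mem_Ico] at hi ⊢
    omega
  · intro i _ hi
    simp only [Finset.mem_insert, Finset.mem_Icc, not_or] at hi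
    simp only [hg]
    split_ifs <;> first | rfl | (exfalso; omega)

theorem mem_altMessages {M : ℕ → ℕ} {N : ℕ} {j j' : Messages M N} {n t : ℕ} :
    j' ∈ altMessages j n t ↔ ∀ i : Fin N, (i.1 + 1 < n → j' i = j i) ∧
      (i.1 + 1 = n → j' i ≠ j i) ∧ (n < i.1 + 1 → t < i.1 + 1 → j' i = j i) := by
  unfold altMessages
  rw [Fintype.mem_piFinset]
  refine forall_congr' fun i => ?_
  split_ifs with h1 h2 h3
  · simp only [Finset.mem_singleton]
    constructor
    · exact fun h => ⟨fun _ => h, fun h' => by omega, fun _ _ => h⟩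
    · exact fun h => h.1 h1
  · simp only [Finset.mem_compl, Finset.mem_singleton]
    constructor
    · exact fun h => ⟨fun _ => by omega, fun _ => h, fun _ _ => by omega⟩
    · exact fun h => h.2.1 h2
  · simp only [Finset.mem_univ, true_iff]
    exact ⟨fun _ => by omega, fun _ => by omega, fun _ _ => by omega⟩
  · simp only [Finset.mem_singleton]
    constructor
    · exact fun h => ⟨fun _ => h, fun h' => by omega, fun _ _ => h⟩
    · exact fun h => h.2.2 (by omega) (by omega)

theorem capped_coe (N t : ℕ) : capped N (t : ℕ∞) = min t N := by
  unfold capped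
  rw [← Nat.mono_cast.map_min]
  rfl

theorem capped_le (N : ℕ) (t : ℕ∞) : capped N t ≤ N := by
  induction t using ENat.recTopCoe with
  | top => simp [capped]
  | coe t => rw [capped_coe]; exact min_le_right _ _

/-! ### Random codebooks -/

/-- A codebook: for each block, the words that encode the messages. -/
abbrev Codebook (T N : ℕ) (M : ℕ → ℕ) : Type := (n : ℕ) → Messages M (min n N) → Block T

/-- The law of a codebook whose words are independent and uniform. -/
noncomputable def codeLaw (T N : ℕ) (M : ℕ → ℕ) : Measure (Codebook T N M) :=
  Measure.infinitePi fun n => Measure.pi fun _ : Messages M (min n N) => inputLaw T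

instance (T N : ℕ) (M : ℕ → ℕ) : IsProbabilityMeasure (codeLaw T N M) := by
  unfold codeLaw; infer_instance

/-- The XOR of the words that are sent for the messages `j` and `j'`. -/
def pathDiff {T N : ℕ} {M : ℕ → ℕ} (j j' : Messages M N) (c : Codebook T N M) (k : ℕ) : Block T :=
  bxor (c k (restrict k j)) (c k (restrict k j'))

theorem measurable_pathDiff {T N : ℕ} {M : ℕ → ℕ} (j j' : Messages M N) :
    Measurable (pathDiff (T := T) j j') := by
  refine measurable_pi_lambda _ fun k => ?_
  have h : Measurable fun c : Messages M (min k N) → Block T =>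
      bxor (c (restrict k j)) (c (restrict k j')) := measurable_of_countable _
  exact h.comp (measurable_pi_apply k)

/-- From the first block on in which two messages differ, the XOR of their random words is uniform
and independent across the blocks. -/
theorem codeLaw_map_pathDiff (ch : Channel) {N : ℕ} {M : ℕ → ℕ} {j j' : Messages M N} {n : ℕ}
    (hlt : ∀ i : Fin N, i.1 + 1 < n → j i = j' i) {i : Fin N} (hi : i.1 + 1 = n)
    (hne : j i ≠ j' i) :
    (codeLaw ch.T N M).map (pathDiff j j') =
      ch.diffLaw.map fun d k => if k < n then fun _ => false else d k := by
  have h1 := Measure.infinitePi_map_pi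
    (μ := fun n => Measure.pi fun _ : Messages M (min n N) => inputLaw ch.T)
    (f := fun k c => bxor (c (restrict k j)) (c (restrict k j')))
    (fun k => measurable_of_countable _)
  have h2 := Measure.infinitePi_map_pi (μ := fun _ : ℕ => inputLaw ch.T)
    (f := fun k (d : Block ch.T) => if k < n then fun _ => false else d)
    (fun k => measurable_of_countable _)
  refine h1.trans (Eq.trans ?_ h2.symm)
  congr 1
  funext k
  by_cases hk : k < n
  · have hr : restrict k j = restrict k j' :=
      (restrict_eq_iff k j j').2 fun i hi => hlt i (by omega)
    simp only [hr, bxor_self, hk, if_true, Measure.map_const, measure_univ]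
  · have hr : restrict k j ≠ restrict k j' := fun h =>
      hne ((restrict_eq_iff k j j').1 h i (by omega))
    simp only [hk, if_false, Measure.map_id', pi_inputLaw_map_bxor hr]

/-- The noise is fixed, so only the law of the codeword differences from block `n` on matters. It is
the same for every alternative tuple first wrong in block `n`. -/
theorem codeLaw_noiseTauBar_le (ch : Channel) (γ : ℕ → ℝ) {N : ℕ} {M : ℕ → ℕ}
    {j j' : Messages M N} {n t : ℕ} (hn : 1 ≤ n) (hnN : n ≤ N) (hj : j' ∈ altMessages j n t)
    (w : ℕ → Bool × Block ch.T) (s : ℕ∞) :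
    codeLaw ch.T N M {c | ch.noiseTauBar γ n (pathDiff j j' c) w ≤ s} =
      ch.diffLaw {d | ch.noiseTauBar γ n d w ≤ s} := by
  rw [mem_altMessages] at hj
  -- The message of block `n` has the zero-based index `n - 1`.
  have hmap := codeLaw_map_pathDiff ch (j := j) (j' := j') (n := n)
    (fun i hi => ((hj i).1 hi).symm) (i := ⟨n - 1, by omega⟩) (by simp; omega)
    (((hj ⟨n - 1, by omega⟩).2.1 (by simp; omega)).symm)
  have hS : MeasurableSet {d | ch.noiseTauBar γ n d w ≤ s} :=
    ((ch.measurable_noiseTauBar γ n).comp (measurable_id.prodMk measurable_const))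
      (MeasurableSet.of_discrete (s := Set.Iic s))
  have hclear : Measurable fun (d : ℕ → Block ch.T) (k : ℕ) =>
      if k < n then (fun _ => false : Block ch.T) else d k := by
    refine measurable_pi_lambda _ fun k => ?_
    by_cases hk : k < n
    · simp only [hk, if_true]; exact measurable_const
    · simp only [hk, if_false]; exact measurable_pi_apply k
  have e1 := Measure.map_apply (μ := codeLaw ch.T N M) (measurable_pathDiff j j') hS
  have e2 := Measure.map_apply (μ := ch.diffLaw) hclear hS
  rw [hmap, e2] at e1
  refine e1.symm.trans ?_
  congr 1
  ext d
  simp only [Set.mem_preimage, Set.mem_ofPred_eq]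
  rw [ch.noiseTauBar_congr γ (d' := d)]
  intro k hk
  rw [if_neg (by omega)]

/-! ### The threshold decoder -/

/-- A sequence that starts, at the index `1`, with the given blocks. -/
def extend {α : Type} [Inhabited α] {n : ℕ} (p : Fin n → α) (k : ℕ) : α :=
  if h : 1 ≤ k ∧ k ≤ n then p ⟨k - 1, by omega⟩ else default

theorem extend_prefixOf {α : Type} [Inhabited α] (y : ℕ → α) {n k : ℕ}
    (hk : k ∈ Finset.Icc 1 n) : extend (prefixOf y n) k = y k := by
  rw [Finset.mem_Icc] at hk
  obtain ⟨m, rfl⟩ : ∃ m, k = m + 1 := ⟨k - 1, by omega⟩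
  simp [extend, prefixOf, hk.2]

theorem eq_of_prefixOf_eq {α : Type} {y y' : ℕ → α} {n k : ℕ} (h : prefixOf y n = prefixOf y' n)
    (hk : k ∈ Finset.Icc 1 n) : y k = y' k := by
  rw [Finset.mem_Icc] at hk
  obtain ⟨m, rfl⟩ : ∃ m, k = m + 1 := ⟨k - 1, by omega⟩
  exact congrFun h ⟨m, by omega⟩

namespace Channel

variable (ch : Channel) {N : ℕ} {M : ℕ → ℕ}

/-- The information density of the words for the messages `j` and the output reaches the threshold
in block `n`. -/
def Crosses (γ : ℕ → ℝ) (c : Codebook ch.T N M) (y : ℕ → Output ch.T) (n : ℕ)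
    (j : Messages M N) : Prop :=
  threshold γ n ≤ ch.densityIcc (fun k => c k (restrict k j)) y 1 n

theorem crosses_congr (γ : ℕ → ℝ) (c : Codebook ch.T N M) {y y' : ℕ → Output ch.T} {n : ℕ}
    (h : ∀ k ∈ Finset.Icc 1 n, y k = y' k) (j : Messages M N) :
    ch.Crosses γ c y n j ↔ ch.Crosses γ c y' n j := by
  unfold Crosses
  rw [ch.densityIcc_congr (fun _ _ => rfl) h]

theorem crosses_out_iff (γ : ℕ → ℝ) (c : Codebook ch.T N M) (w : ℕ → Bool × Block ch.T) (n : ℕ)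
    (j j' : Messages M N) :
    ch.Crosses γ c (fun k => ch.out (c k (restrict k j)) (w k)) n j' ↔
      threshold γ n ≤ ch.densityIcc (pathDiff j j' c) w 1 n := by
  unfold Crosses
  rw [densityIcc_out]
  rfl

/-- The stopping time of the threshold decoder: the first block in which some messages reach the
threshold. -/
noncomputable def codeTau (γ : ℕ → ℝ) (c : Codebook ch.T N M) (y : ℕ → Output ch.T) : ℕ∞ :=
  ⨅ k : {k : ℕ // 1 ≤ k ∧ ∃ j, ch.Crosses γ c y k j}, (k.1 : ℕ∞)

open Classical in
/-- The threshold decoder: it chooses messages that reach the threshold, if there are any. -/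
noncomputable def codeDec (γ : ℕ → ℝ) (c : Codebook ch.T N M) (j₀ : Messages M N) (n : ℕ)
    (p : Fin n → Output ch.T) : Messages M (min n N) :=
  if h : ∃ j, ch.Crosses γ c (extend p) n j then restrict n h.choose else restrict n j₀

theorem exists_codeDec_eq (γ : ℕ → ℝ) (c : Codebook ch.T N M) (j₀ : Messages M N) {n : ℕ}
    {y : ℕ → Output ch.T} (h : ∃ j, ch.Crosses γ c y n j) :
    ∃ j, ch.Crosses γ c y n j ∧ ch.codeDec γ c j₀ n (prefixOf y n) = restrict n j := by
  have he : ∀ j, ch.Crosses γ c (extend (prefixOf y n)) n j ↔ ch.Crosses γ c y n j :=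
    ch.crosses_congr γ c fun k hk => extend_prefixOf y hk
  have h' : ∃ j, ch.Crosses γ c (extend (prefixOf y n)) n j := h.imp fun j => (he j).2
  exact ⟨h'.choose, (he _).1 h'.choose_spec, dif_pos h'⟩

theorem one_le_codeTau (γ : ℕ → ℝ) (c : Codebook ch.T N M) (y : ℕ → Output ch.T) :
    1 ≤ ch.codeTau γ c y :=
  le_iInf fun k => by exact_mod_cast k.2.1

theorem codeTau_adapted (γ : ℕ → ℝ) (c : Codebook ch.T N M) (n : ℕ) (y y' : ℕ → Output ch.T)
    (h : prefixOf y n = prefixOf y' n) (hy : ch.codeTau γ c y = n) : ch.codeTau γ c y' = n := by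
  have he : ∀ k ≤ n, (∃ j, ch.Crosses γ c y k j) ↔ ∃ j, ch.Crosses γ c y' k j := fun k hk =>
    exists_congr fun j => ch.crosses_congr γ c (fun i hi => eq_of_prefixOf_eq h
      (Finset.Icc_subset_Icc le_rfl hk hi)) j
  obtain ⟨h1, h2⟩ := iInf_hit_eq_iff.1 hy
  refine iInf_hit_eq_iff.2 ⟨⟨h1.1, (he n le_rfl).1 h1.2⟩, fun k hk hc => h2 k hk ?_⟩
  exact ⟨hc.1, (he k hk.le).2 hc.2⟩

/-- The decoder never stops after the hitting time of the transmitted messages. -/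
theorem codeTau_le_noiseTau (γ : ℕ → ℝ) (c : Codebook ch.T N M) (j : Messages M N)
    (w : ℕ → Bool × Block ch.T) :
    ch.codeTau γ c (fun k => ch.out (c k (restrict k j)) (w k)) ≤ ch.noiseTau γ w := by
  refine le_iInf fun k => ?_
  refine iInf_hit_le_iff.2 ⟨k.1, ⟨k.2.1, j, ?_⟩, le_rfl⟩
  rw [crosses_out_iff]
  have : pathDiff j j c = fun _ _ => false := funext fun k => bxor_self _
  rw [this]
  exact k.2.2

/-- The number of wrong messages that reach the threshold no later than the transmitted messages
`j`, up to the block in which the latter do. -/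
noncomputable def badCount (γ : ℕ → ℝ) (j : Messages M N) (c : Codebook ch.T N M)
    (w : ℕ → Bool × Block ch.T) : ℝ≥0∞ :=
  ∑ n ∈ Finset.Icc 1 (capped N (ch.noiseTau γ w)),
    ∑ j' ∈ altMessages j n (capped N (ch.noiseTau γ w)),
      {w | ch.noiseTauBar γ n (pathDiff j j' c) w ≤ ch.noiseTau γ w}.indicator 1 w

/-- The decoder stops no later than τ, at a tuple that crosses and whose relevant part is wrong.
Resetting its entries after min(τ, N) turns it into one of the counted alternatives. -/
theorem one_le_badCount (γ : ℕ → ℝ) (c : Codebook ch.T N M) (j₀ j : Messages M N)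
    {w : ℕ → Bool × Block ch.T} (hw : ch.noiseTau γ w ≠ ⊤)
    (herr : ¬ ∃ n : ℕ, ch.codeTau γ c (fun k => ch.out (c k (restrict k j)) (w k)) = n ∧
      ch.codeDec γ c j₀ n (prefixOf (fun k => ch.out (c k (restrict k j)) (w k)) n) =
        restrict n j) :
    1 ≤ ch.badCount γ j c w := by
  have hle := ch.codeTau_le_noiseTau γ c j w
  set y := fun k => ch.out (c k (restrict k j)) (w k) with hy
  obtain ⟨m, hm⟩ := ENat.ne_top_iff_exists.1 hw
  rw [← hm] at hle
  obtain ⟨n, hn⟩ := ENat.ne_top_iff_exists.1 (ne_top_of_le_ne_top (ENat.natCast_ne_top m) hle)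
  have hnm : n ≤ m := by rw [← hn] at hle; exact_mod_cast hle
  obtain ⟨⟨h1n, hcross⟩, -⟩ := iInf_hit_eq_iff.1 hn.symm
  obtain ⟨j₁, hj₁, hdec⟩ := ch.exists_codeDec_eq γ c j₀ hcross
  have hne : restrict n j₁ ≠ restrict n j := fun h => herr ⟨n, hn.symm, hdec.trans h⟩
  -- The first wrong message, which belongs to block `i + 1`.
  obtain ⟨i, ⟨hin, hij⟩, hmin⟩ := WellFounded.has_min (r := ((· < ·) : Fin N → Fin N → Prop))
    wellFounded_lt {i : Fin N | i.1 < n ∧ j₁ i ≠ j i} (by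
      rw [Ne, restrict_eq_iff] at hne
      push Not at hne
      exact hne)
  have hmin' : ∀ i' : Fin N, i'.1 < i.1 → j₁ i' = j i' := fun i' hi' => by
    by_contra h
    exact hmin i' ⟨hi'.trans hin, h⟩ hi'
  have hcap : capped N (ch.noiseTau γ w) = min m N := by rw [← hm, capped_coe]
  -- The stopping block `n` is at most `m`, so the reset entries do not affect the words of blocks
  -- `1, …, n` and the crossing persists.
  set j₂ : Messages M N := fun i => if i.1 + 1 ≤ min m N then j₁ i else j i with hj₂
  have hmem : j₂ ∈ altMessages j (i.1 + 1) (min m N) := by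
    rw [mem_altMessages]
    intro i'
    refine ⟨fun h => ?_, fun h => ?_, fun _ h => ?_⟩
    · simp only [hj₂]
      split_ifs
      · exact hmin' i' (by omega)
      · rfl
    · obtain rfl : i' = i := Fin.ext (by omega)
      simp only [hj₂]
      rwa [if_pos (by have := i'.2; omega)]
    · simp only [hj₂]
      rw [if_neg (by omega)]
  have hcross₂ : ch.Crosses γ c y n j₂ := by
    unfold Crosses at hj₁ ⊢
    convert hj₁ using 1
    refine ch.densityIcc_congr (fun k hk => ?_) fun _ _ => rfl
    congr 1
    rw [restrict_eq_iff]
    intro i' hi'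
    simp only [hj₂]
    rw [Finset.mem_Icc] at hk
    rw [if_pos (by have := i'.2; omega)]
  have hbar : ch.noiseTauBar γ (i.1 + 1) (pathDiff j j₂ c) w ≤ ch.noiseTau γ w := by
    rw [← hm]
    refine iInf_hit_le_iff.2 ⟨n, ⟨hin, ?_⟩, hnm⟩
    rw [hy, crosses_out_iff] at hcross₂
    -- Before block `i + 1` the words of both tuples coincide, so the first part of the sum is the
    -- density of the transmitted words.
    rw [← ch.densityIcc_add (pathDiff j j₂ c) w (n := i.1 + 1) (by omega) hin] at hcross₂
    convert hcross₂ using 2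
    refine ch.densityIcc_congr (fun k hk => ?_) fun _ _ => rfl
    rw [Finset.mem_Icc] at hk
    have : restrict k j = restrict k j₂ := (restrict_eq_iff k j j₂).2 fun i' hi' =>
      (((mem_altMessages.1 hmem) i').1 (by omega)).symm
    simp only [pathDiff, this, bxor_self]
  unfold badCount
  rw [hcap]
  calc (1 : ℝ≥0∞) = {w | ch.noiseTauBar γ (i.1 + 1) (pathDiff j j₂ c) w ≤
        ch.noiseTau γ w}.indicator 1 w := by
        rw [Set.indicator_of_mem (by exact hbar), Pi.one_apply]
    _ ≤ ∑ j' ∈ altMessages j (i.1 + 1) (min m N),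
        {w | ch.noiseTauBar γ (i.1 + 1) (pathDiff j j' c) w ≤ ch.noiseTau γ w}.indicator 1 w :=
        Finset.single_le_sum (f := fun j' => {w | ch.noiseTauBar γ (i.1 + 1) (pathDiff j j' c) w ≤
          ch.noiseTau γ w}.indicator (fun _ => (1 : ℝ≥0∞)) w) (fun _ _ => zero_le) hmem
    _ ≤ _ := Finset.single_le_sum (f := fun n => ∑ j' ∈ altMessages j n (min m N),
          {w | ch.noiseTauBar γ n (pathDiff j j' c) w ≤ ch.noiseTau γ w}.indicator
            (fun _ => (1 : ℝ≥0∞)) w) (fun _ _ => zero_le)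
          (Finset.mem_Icc.2 ⟨by omega, by have := i.2; omega⟩)

/-! ### The average over the codebooks -/

/-- The index sets of the sums below depend on τ, which has countably many values; measurability is
checked with the value frozen. -/
theorem measurable_apply_of_countable {Ω ι B : Type*} [MeasurableSpace Ω] [MeasurableSpace B]
    [Countable ι] [MeasurableSpace ι] [MeasurableSingletonClass ι] {t : Ω → ι}
    (ht : Measurable t) {F : ι → Ω → B} (hF : ∀ i, Measurable (F i)) :
    Measurable fun ω => F (t ω) ω := by
  have h : Measurable fun p : ι × Ω => F p.1 p.2 := measurable_from_prod_countable_right hF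
  have h' : Measurable fun ω => (t ω, ω) := ht.prodMk measurable_id
  exact h.comp h'

theorem measurableSet_noiseTauBar_le (γ : ℕ → ℝ) (n : ℕ) {Ω : Type*} [MeasurableSpace Ω]
    {d : Ω → ℕ → Block ch.T} (hd : Measurable d) {w : Ω → ℕ → Bool × Block ch.T}
    (hw : Measurable w) :
    MeasurableSet {ω | ch.noiseTauBar γ n (d ω) (w ω) ≤ ch.noiseTau γ (w ω)} := by
  have h1 : Measurable fun ω => ch.noiseTauBar γ n (d ω) (w ω) :=
    measurable_apply₂ (f := ch.noiseTauBar γ n) (ch.measurable_noiseTauBar γ n) hd hw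
  have h2 : Measurable fun ω => ch.noiseTau γ (w ω) := (ch.measurable_noiseTau γ).comp hw
  exact (h1.prodMk h2) (MeasurableSet.of_discrete (s := {p : ℕ∞ × ℕ∞ | p.1 ≤ p.2}))

theorem measurable_badCount (γ : ℕ → ℝ) (j : Messages M N) :
    Measurable fun p : Codebook ch.T N M × (ℕ → Bool × Block ch.T) =>
      ch.badCount γ j p.1 p.2 := by
  have hT : Measurable fun p : Codebook ch.T N M × (ℕ → Bool × Block ch.T) =>
      capped N (ch.noiseTau γ p.2) :=
    (measurable_of_countable (capped N)).comp ((ch.measurable_noiseTau γ).comp measurable_snd)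
  refine measurable_apply_of_countable hT (F := fun t p => ∑ n ∈ Finset.Icc 1 t,
    ∑ j' ∈ altMessages j n t,
      {w | ch.noiseTauBar γ n (pathDiff j j' p.1) w ≤ ch.noiseTau γ w}.indicator
        (fun _ => (1 : ℝ≥0∞)) p.2) fun t => ?_
  refine Finset.measurable_fun_sum _ fun n _ => Finset.measurable_fun_sum _ fun j' _ => ?_
  refine Measurable.indicator (f := fun _ : Codebook ch.T N M × (ℕ → Bool × Block ch.T) =>
    (1 : ℝ≥0∞)) measurable_const (ch.measurableSet_noiseTauBar_le γ n
    ((measurable_pathDiff j j').comp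
      (measurable_fst (α := Codebook ch.T N M) (β := ℕ → Bool × Block ch.T))) measurable_snd)

/-- The bound on the error probability, as a function of the noise and of the XOR of the inputs
and their copies. -/
noncomputable def weightedCount (N : ℕ) (M : ℕ → ℕ) (γ : ℕ → ℝ)
    (p : (ℕ → Block ch.T) × (ℕ → Bool × Block ch.T)) : ℝ≥0∞ :=
  ∑ n ∈ Finset.Icc 1 (capped N (ch.noiseTau γ p.2)),
    (Mtilde N M n (ch.noiseTau γ p.2) : ℝ≥0∞) *
      {p | ch.noiseTauBar γ n p.1 p.2 ≤ ch.noiseTau γ p.2}.indicator 1 p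

theorem measurable_weightedCount (γ : ℕ → ℝ) : Measurable (ch.weightedCount N M γ) := by
  have hT : Measurable fun p : (ℕ → Block ch.T) × (ℕ → Bool × Block ch.T) =>
      ch.noiseTau γ p.2 := (ch.measurable_noiseTau γ).comp measurable_snd
  refine measurable_apply_of_countable hT (F := fun t p => ∑ n ∈ Finset.Icc 1 (capped N t),
    (Mtilde N M n t : ℝ≥0∞) * {p | ch.noiseTauBar γ n p.1 p.2 ≤ ch.noiseTau γ p.2}.indicator
        (fun _ => (1 : ℝ≥0∞)) p) fun t => ?_
  refine Finset.measurable_fun_sum _ fun n _ => measurable_const.mul ?_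
  exact measurable_one.indicator (ch.measurableSet_noiseTauBar_le γ n measurable_fst measurable_snd)

/-- For fixed noise τ is a constant, and all alternatives in the `n`-th group have equal crossing
probability. Each inner sum becomes its cardinality times that probability. -/
theorem lintegral_codeLaw_badCount (γ : ℕ → ℝ) (j : Messages M N) (w : ℕ → Bool × Block ch.T) :
    ∫⁻ c, ch.badCount γ j c w ∂codeLaw ch.T N M =
      ∫⁻ d, ch.weightedCount N M γ (d, w) ∂ch.diffLaw := by
  have hind1 : ∀ n j', (fun c : Codebook ch.T N M =>
      {w | ch.noiseTauBar γ n (pathDiff j j' c) w ≤ ch.noiseTau γ w}.indicator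
        (1 : (ℕ → Bool × Block ch.T) → ℝ≥0∞) w) =
      {c | ch.noiseTauBar γ n (pathDiff j j' c) w ≤ ch.noiseTau γ w}.indicator 1 := fun _ _ => rfl
  have hind2 : ∀ n, (fun d : ℕ → Block ch.T =>
      {p : (ℕ → Block ch.T) × (ℕ → Bool × Block ch.T) |
        ch.noiseTauBar γ n p.1 p.2 ≤ ch.noiseTau γ p.2}.indicator 
        (1 : (ℕ → Block ch.T) × (ℕ → Bool × Block ch.T) → ℝ≥0∞) (d, w)) =
      {d | ch.noiseTauBar γ n d w ≤ ch.noiseTau γ w}.indicator 1 := fun _ => rfl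
  have hm1 : ∀ n j', MeasurableSet {c : Codebook ch.T N M |
      ch.noiseTauBar γ n (pathDiff j j' c) w ≤ ch.noiseTau γ w} := fun n j' =>
    ch.measurableSet_noiseTauBar_le γ n (measurable_pathDiff j j') measurable_const
  have hm2 : ∀ n, MeasurableSet {d | ch.noiseTauBar γ n d w ≤ ch.noiseTau γ w} := fun n =>
    ch.measurableSet_noiseTauBar_le γ n measurable_id measurable_const
  unfold badCount weightedCount
  dsimp only
  rw [lintegral_finsetSum, lintegral_finsetSum]
  · refine Finset.sum_congr rfl fun n hn => ?_
    rw [Finset.mem_Icc] at hn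
    have hN := capped_le N (ch.noiseTau γ w)
    rw [lintegral_finsetSum]
    · rw [lintegral_const_mul _ (by rw [hind2]; exact measurable_one.indicator (hm2 n)), hind2,
        lintegral_indicator_one (hm2 n)]
      rw [Finset.sum_congr rfl fun j' hj' => by
        rw [hind1, lintegral_indicator_one (hm1 n j'),
          codeLaw_noiseTauBar_le ch γ hn.1 (hn.2.trans hN) hj' w]]
      rw [Finset.sum_const, card_altMessages j hn.1 hn.2 hN, nsmul_eq_mul]
      rfl
    · intro j' _
      rw [hind1]
      exact measurable_one.indicator (hm1 n j')
  · intro n _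
    refine measurable_const.mul ?_
    rw [hind2]
    exact measurable_one.indicator (hm2 n)
  · intro n _
    refine Finset.measurable_fun_sum _ fun j' _ => ?_
    rw [hind1]
    exact measurable_one.indicator (hm1 n j')

theorem lintegral_lintegral_badCount (γ : ℕ → ℝ) (j : Messages M N) :
    ∫⁻ c, ∫⁻ w, ch.badCount γ j c w ∂ch.pathLaw ∂codeLaw ch.T N M =
      ∫⁻ p, ch.weightedCount N M γ p ∂ch.diffLaw.prod ch.pathLaw := by
  rw [lintegral_lintegral_swap (ch.measurable_badCount γ j).aemeasurable]
  simp_rw [lintegral_codeLaw_badCount]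
  rw [lintegral_prod_symm' _ (ch.measurable_weightedCount γ)]

theorem lintegral_sampleLaw_tau (γ : ℕ → ℝ) :
    ∫⁻ ω, (ch.tau γ ω : ℝ≥0∞) ∂ch.sampleLaw =
      ∫⁻ w, (ch.noiseTau γ w : ℝ≥0∞) ∂ch.pathLaw := by
  have hm : Measurable fun p : (ℕ → Block ch.T) × (ℕ → Bool × Block ch.T) =>
      (ch.noiseTau γ p.2 : ℝ≥0∞) :=
    (measurable_of_countable (fun t : ℕ∞ => (t : ℝ≥0∞))).comp
      ((ch.measurable_noiseTau γ).comp measurable_snd)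
  have := ch.lintegral_sampleLaw hm
  simp_rw [tau_eq]
  rw [this, lintegral_prod _ hm.aemeasurable]
  simp

theorem lintegral_sampleLaw_error (N : ℕ) (M : ℕ → ℕ) (γ : ℕ → ℝ) :
    ∫⁻ ω, ∑ n ∈ Finset.Icc 1 (capped N (ch.tau γ ω)),
        (Mtilde N M n (ch.tau γ ω) : ℝ≥0∞) *
          Set.indicator {ω' | ch.tauBar γ n ω' ≤ ch.tau γ ω'} 1 ω ∂ch.sampleLaw =
      ∫⁻ p, ch.weightedCount N M γ p ∂ch.diffLaw.prod ch.pathLaw := by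
  rw [← ch.lintegral_sampleLaw (ch.measurable_weightedCount γ)]
  refine lintegral_congr fun ω => ?_
  simp only [weightedCount, tau_eq, tauBar_eq, Set.indicator_apply, Set.mem_ofPred_eq]
  rfl

end Channel

/-! ### Choice of a code -/

theorem sum_div_card_le {ι : Type*} [Fintype ι] [Nonempty ι] {f : ι → ℝ≥0∞} {r : ℝ≥0∞}
    (h : ∀ i, f i ≤ r) : (∑ i, f i) / (Fintype.card ι : ℝ≥0∞) ≤ r := by
  refine ENNReal.div_le_of_le_mul ?_
  calc ∑ i, f i ≤ ∑ _i : ι, r := Finset.sum_le_sum fun i _ => h i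
    _ = r * Fintype.card ι := by rw [Finset.sum_const, Finset.card_univ, nsmul_eq_mul, mul_comm]

theorem sum_const_div_card {ι : Type*} [Fintype ι] [Nonempty ι] (r : ℝ≥0∞) :
    (∑ _i : ι, r) / (Fintype.card ι : ℝ≥0∞) = r := by
  rw [Finset.sum_const, Finset.card_univ, nsmul_eq_mul, mul_comm]
  exact ENNReal.mul_div_cancel_right (by simp) (by simp)

namespace Channel

variable (ch : Channel) {N : ℕ} {M : ℕ → ℕ}

/-- Some codebook is at least as good as the average. -/
theorem exists_codebook [Nonempty (Messages M N)] (γ : ℕ → ℝ) :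
    ∃ c : Codebook ch.T N M,
      (∑ j : Messages M N, ∫⁻ w, ch.badCount γ j c w ∂ch.pathLaw) /
        (Fintype.card (Messages M N) : ℝ≥0∞) ≤
      ∫⁻ p, ch.weightedCount N M γ p ∂ch.diffLaw.prod ch.pathLaw := by
  have hm : ∀ j : Messages M N, Measurable fun c => ∫⁻ w, ch.badCount γ j c w ∂ch.pathLaw :=
    fun j => (ch.measurable_badCount γ j).lintegral_prod_right'
  have hm' : Measurable fun c => (∑ j : Messages M N, ∫⁻ w, ch.badCount γ j c w ∂ch.pathLaw) /
      (Fintype.card (Messages M N) : ℝ≥0∞) :=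
    (Finset.measurable_fun_sum _ fun j _ => hm j).div_const _
  obtain ⟨c, hc⟩ := exists_le_lintegral (μ := codeLaw ch.T N M) hm'.aemeasurable
  refine ⟨c, hc.trans_eq ?_⟩
  simp_rw [div_eq_mul_inv]
  rw [lintegral_mul_const _ (Finset.measurable_fun_sum _ fun j _ => hm j),
    lintegral_finsetSum _ fun j _ => hm j]
  simp_rw [lintegral_lintegral_badCount]
  rw [← div_eq_mul_inv, sum_const_div_card]

theorem exists_code_of_lintegral_lt_top [Nonempty (Messages M N)] (γ : ℕ → ℝ)
    (hfin : ∫⁻ w, (ch.noiseTau γ w : ℝ≥0∞) ∂ch.pathLaw < ⊤) :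
    ∃ l ε : ℝ≥0, Nonempty (SFCode ch N M l ε) ∧
      (l : ℝ≥0∞) ≤ ∫⁻ w, (ch.noiseTau γ w : ℝ≥0∞) ∂ch.pathLaw ∧
      (ε : ℝ≥0∞) ≤ ∫⁻ p, ch.weightedCount N M γ p ∂ch.diffLaw.prod ch.pathLaw := by
  obtain ⟨c, hc⟩ := ch.exists_codebook (N := N) (M := M) γ
  obtain ⟨j₀⟩ := ‹Nonempty (Messages M N)›
  have : Nonempty (Messages M N) := ⟨j₀⟩
  -- A run with τ = ∞ might never stop and count as an error without any wrong tuple crossing; a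
  -- finite mean makes such runs negligible.
  have hae : ∀ᵐ w ∂ch.pathLaw, ch.noiseTau γ w ≠ ⊤ := by
    have := ae_lt_top ((measurable_of_countable (fun t : ℕ∞ => (t : ℝ≥0∞))).comp
      (ch.measurable_noiseTau γ)) hfin.ne
    filter_upwards [this] with w hw h
    simp [h] at hw
  set L := (∑ j : Messages M N, ∫⁻ w, (ch.codeTau γ c
    (fun k => ch.out (c k (restrict k j)) (w k)) : ℝ≥0∞) ∂ch.pathLaw) /
      (Fintype.card (Messages M N) : ℝ≥0∞) with hL
  set E := (∑ j : Messages M N, ch.pathLaw {w | ¬ ∃ n : ℕ,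
      ch.codeTau γ c (fun k => ch.out (c k (restrict k j)) (w k)) = n ∧
      ch.codeDec γ c j₀ n (prefixOf (fun k => ch.out (c k (restrict k j)) (w k)) n) =
        restrict n j}) / (Fintype.card (Messages M N) : ℝ≥0∞) with hE
  have hLle : L ≤ ∫⁻ w, (ch.noiseTau γ w : ℝ≥0∞) ∂ch.pathLaw := sum_div_card_le fun j =>
    lintegral_mono fun w => by
      exact ENat.toENNReal_le.2 (ch.codeTau_le_noiseTau γ c j w)
  have hE1 : E ≤ 1 := sum_div_card_le fun j => prob_le_one
  have hEle : E ≤ ∫⁻ p, ch.weightedCount N M γ p ∂ch.diffLaw.prod ch.pathLaw := by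
    -- On almost every error path the count is at least one, so Markov's inequality at level 1 is
    -- the union bound.
    refine le_trans ?_ hc
    refine ENNReal.div_le_div_right (Finset.sum_le_sum fun j _ => ?_) _
    have hmeas : Measurable fun w => ch.badCount γ j c w :=
      measurable_apply₂ (f := ch.badCount γ j) (ch.measurable_badCount γ j)
        measurable_const measurable_id
    calc _ ≤ ch.pathLaw {w | 1 ≤ ch.badCount γ j c w} := by
          refine measure_mono_ae ?_
          filter_upwards [hae] with w hw herr
          exact ch.one_le_badCount γ c j₀ j hw herr
      _ = 1 * ch.pathLaw {w | 1 ≤ ch.badCount γ j c w} := (one_mul _).symm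
      _ ≤ _ := mul_meas_ge_le_lintegral hmeas 1
  have hLt : L ≠ ⊤ := (hLle.trans_lt hfin).ne
  have hEt : E ≠ ⊤ := (hE1.trans_lt ENNReal.one_lt_top).ne
  refine ⟨L.toNNReal, E.toNNReal, ⟨⟨c, ch.codeDec γ c j₀, ch.codeTau γ c, ch.one_le_codeTau γ c,
    ch.codeTau_adapted γ c, ?_, ?_⟩⟩, ?_, ?_⟩
  · rw [ENNReal.coe_toNNReal hLt]
  · rw [ENNReal.coe_toNNReal hEt]
  · rwa [ENNReal.coe_toNNReal hLt]
  · rwa [ENNReal.coe_toNNReal hEt]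

/-- When τ = ∞ the event τ̄_n ≤ τ is certain, and the term of any block with at least two messages
is already at least one. -/
theorem one_le_lintegral_weightedCount (γ : ℕ → ℝ) (hM : ∀ n ∈ Finset.Icc 1 N, 1 ≤ M n)
    (htop : ∀ᵐ w ∂ch.pathLaw, ch.noiseTau γ w = ⊤) {n : ℕ} (hn : n ∈ Finset.Icc 1 N)
    (hMn : 2 ≤ M n) :
    1 ≤ ∫⁻ p, ch.weightedCount N M γ p ∂ch.diffLaw.prod ch.pathLaw := by
  have htop' : ∀ᵐ p ∂ch.diffLaw.prod ch.pathLaw, ch.noiseTau γ p.2 = ⊤ :=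
    Measure.quasiMeasurePreserving_snd.ae htop
  calc (1 : ℝ≥0∞) = ∫⁻ _, 1 ∂ch.diffLaw.prod ch.pathLaw := by simp
    _ ≤ _ := by
      refine lintegral_mono_ae ?_
      filter_upwards [htop'] with p hp
      have hc : capped N ⊤ = N := by simp [capped]
      have hpos : 1 ≤ Mtilde N M n ⊤ := by
        refine Nat.mul_pos (by omega) (Finset.prod_pos fun i hi => ?_)
        rw [hc, Finset.mem_Icc] at hi
        rw [Finset.mem_Icc] at hn
        exact hM i (Finset.mem_Icc.2 ⟨by omega, hi.2⟩)
      unfold weightedCount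
      rw [hp, hc]
      refine le_trans ?_ (Finset.single_le_sum (f := fun n => (Mtilde N M n ⊤ : ℝ≥0∞) *
        {p : (ℕ → Block ch.T) × (ℕ → Bool × Block ch.T) |
          ch.noiseTauBar γ n p.1 p.2 ≤ ch.noiseTau γ p.2}.indicator 1 p)
        (fun _ _ => zero_le) hn)
      rw [Set.indicator_of_mem (by
        change ch.noiseTauBar γ n p.1 p.2 ≤ ch.noiseTau γ p.2
        rw [hp]; exact le_top), Pi.one_apply, mul_one]
      exact_mod_cast hpos

theorem exists_code_of_ae_eq_top [Nonempty (Messages M N)] (γ : ℕ → ℝ)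
    (hM : ∀ n ∈ Finset.Icc 1 N, 1 ≤ M n)
    (htop : ∀ᵐ w ∂ch.pathLaw, ch.noiseTau γ w = ⊤) :
    ∃ l ε : ℝ≥0, Nonempty (SFCode ch N M l ε) ∧
      (l : ℝ≥0∞) ≤ ∫⁻ w, (ch.noiseTau γ w : ℝ≥0∞) ∂ch.pathLaw ∧
      (ε : ℝ≥0∞) ≤ ∫⁻ p, ch.weightedCount N M γ p ∂ch.diffLaw.prod ch.pathLaw := by
  obtain ⟨j₀⟩ := ‹Nonempty (Messages M N)›
  have : Nonempty (Messages M N) := ⟨j₀⟩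
  set E := (∑ j : Messages M N, ch.pathLaw {_w | ¬ ∃ n : ℕ, (1 : ℕ∞) = n ∧
    restrict n j₀ = restrict n j}) / (Fintype.card (Messages M N) : ℝ≥0∞) with hE
  have hE1 : E ≤ 1 := sum_div_card_le fun j => prob_le_one
  have hEt : E ≠ ⊤ := (hE1.trans_lt ENNReal.one_lt_top).ne
  -- The code sends zero words, stops after one block and guesses `j₀`; its length 1 is below E[τ] =
  -- ∞.
  refine ⟨1, E.toNNReal, ⟨⟨fun _ _ _ => false, fun n _ => restrict n j₀, fun _ => 1,
    fun _ => le_rfl, fun _ _ _ _ h => h, ?_, ?_⟩⟩, ?_, ?_⟩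
  · exact sum_div_card_le fun j => by simp
  · rw [ENNReal.coe_toNNReal hEt]
  · rw [lintegral_congr_ae (htop.mono fun w hw => by rw [hw])]
    simp
  · rw [ENNReal.coe_toNNReal hEt]
    by_cases h : ∃ n ∈ Finset.Icc 1 N, 2 ≤ M n
    · obtain ⟨n, hn, hMn⟩ := h
      exact hE1.trans (ch.one_le_lintegral_weightedCount γ hM htop hn hMn)
    · push Not at h
      -- All message sets are singletons, so the guess is always correct and the error is zero.
      have hsub : ∀ j : Messages M N, j₀ = j := fun j => funext fun i => by
        have := h (i.1 + 1) (Finset.mem_Icc.2 ⟨by omega, i.2⟩)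
        refine Fin.ext ?_
        have h1 := (j₀ i).2
        have h2 := (j i).2
        omega
      refine (sum_div_card_le (r := 0) fun j => ?_).trans zero_le
      have : {w : ℕ → Bool × Block ch.T | ¬ ∃ n : ℕ, (1 : ℕ∞) = n ∧
          restrict n j₀ = restrict n j} = ∅ := by
        refine Set.eq_empty_of_forall_notMem fun w hw => hw ⟨1, by simp, ?_⟩
        rw [hsub j]
      rw [this, measure_empty]

end Channel

end EMS

theorem theorem2 (ch : EMS.Channel) (N : ℕ) (hN : 1 ≤ N)
    (M : ℕ → ℕ) (hM : ∀ n ∈ Finset.Icc 1 N, 1 ≤ M n)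
    (γ : ℕ → ℝ) (hγ : ∀ n, N < n → γ n = 0) :
    ∃ l ε : ℝ≥0,
      Nonempty (EMS.SFCode ch N M l ε) ∧
      (l : ℝ≥0∞) ≤ ∫⁻ ω, (ch.tau γ ω : ℝ≥0∞) ∂ch.sampleLaw ∧
      (ε : ℝ≥0∞) ≤ ∫⁻ ω, ∑ n ∈ Finset.Icc 1 (EMS.capped N (ch.tau γ ω)),
        (EMS.Mtilde N M n (ch.tau γ ω) : ℝ≥0∞) *
          Set.indicator {ω' | ch.tauBar γ n ω' ≤ ch.tau γ ω'} 1 ω ∂ch.sampleLaw := by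
  have : Nonempty (EMS.Messages M N) :=
    ⟨fun i => ⟨0, hM (i.1 + 1) (Finset.mem_Icc.2 ⟨by omega, i.2⟩)⟩⟩
  rw [ch.lintegral_sampleLaw_tau, ch.lintegral_sampleLaw_error]
  rcases ch.lintegral_noiseTau_lt_top_or γ hγ with hfin | htop
  · exact ch.exists_code_of_lintegral_lt_top γ hfin
  · exact ch.exists_code_of_ae_eq_top γ hM htop
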